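/- Let $\mathcal X,\mathcal Y$ be finite alphabets, let $W(y|x)$ be the transition probabilities of a discrete memoryless channel, and let $P_X$ be a distribution on $\mathcal X$ with rational probabilities (so that its type classes are nonempty for infinitely many block lengths). Let $R>0$ be a rate in nats and let $\mathsf E\in\mathbb R$, $\mathsf E\neq 0$, be a target error exponent. Logarithms are natural. Notation. $\hat Q_{\mathbf x}$, $\hat Q_{\mathbf y}$ and $\hat Q_{\mathbf x\mathbf y}$ denote (joint) empirical distributions, $\mathcal T_{P_X}\subseteq\mathcal X^n$ is the set of all $\mathbf x$ with $\hat Q_{\mathbf x}=P_X$, $P(\mathbf y|\mathbf x)=\prod_{i=1}^n W(y_i|x_i)$, and $\mathcal S(\mathcal Y)$ is the probability simplex over $\mathcal Y$. The letters $Q,\tilde Q,Q'$ denote joint distributions on $\mathcal X\times\mathcal Y$ with $\mathcal X$-marginal $P_X$; $Q_Y$ is the $\mathcal Y$-marginal, $Q_{Y|X}$ the conditional distribution, $I(Q)$ the mutual information, $D(Q_{Y|X}\|W|P_X)$ the conditional divergence averaged over $P_X$ (possibly $+\infty$), and $f(Q)=\sum_{x,y}Q(x,y)\log W(y|x)\in[-\infty,0]$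 with $0\log 0=0$. A codebook consists of $M=\lceil e^{nR}\rceil$ codewords $\mathbf x_1,\dots,\mathbf x_M$, drawn independently and uniformly from $\mathcal T_{P_X}$; an overline denotes the average over this ensemble. For a list decoder $\phi$ with decoding regions $\mathcal R_m\subseteq\mathcal Y^n$ (message $m$ is on the list iff $\mathbf y\in\mathcal R_m$) let $$P_e(\mathcal C,\phi)=\frac1M\sum_{m=1}^M\sum_{\mathbf y\notin\mathcal R_m}P(\mathbf y|\mathbf x_m),\qquad L(\mathcal C,\phi)=\frac1M\sum_{l=1}^M\sum_{\mathbf y\in\mathcal R_l}\sum_{m\ne l}P(\mathbf y|\mathbf x_m),$$ $$E_e(R,\phi)=\liminf_{n\to\infty}-\frac1n\log\overline{P_e(\mathcal C,\phi)},\qquad E_l(R,\phi)=\liminf_{n\to\infty}-\frac1n\log\overline{L(\mathcal C,\phi)},$$ where $n$ runs over the block lengths with $\mathcal T_{P_X}\neq\emptyset$ and $-\log 0=+\infty$. Let $\Lambda_1$ be the class of decoders $\phi_g$ with regions $\mathcal R_m=\{\mathbf y: f(\hat Q_{\mathbf x_m\mathbf y})\ge g(\hat Q_{\mathbf y})\}$,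 where $g$ is real-valued and continuous on some compact $\mathcal G\subseteq\mathcal S(\mathcal Y)$ and equals $+\infty$ on $\mathcal S(\mathcal Y)\setminus\mathcal G$; write $E_e(R,g)$, $E_l(R,g)$ for the exponents of $\phi_g$. Put $$g^*(Q_Y,\mathsf E)=\min_{Q':\,Q'_Y=Q_Y,\;D(Q'_{Y|X}\|W|P_X)\le\mathsf E}f(Q'),$$ with value $+\infty$ if no $Q'$ is feasible. Then the minimum is attained whenever it is feasible, and $g^*(\cdot,\mathsf E)$ is an optimal threshold function for $\Lambda_1$: the decoder $\phi_{g^*}$ belongs to $\Lambda_1$, it satisfies $E_e(R,g^*)\ge\mathsf E$, and every $\phi_g\in\Lambda_1$ with $E_e(R,g)\ge\mathsf E$ satisfies $E_l(R,g)\le E_l(R,g^*)$. The resulting list size exponent is $$E_l(R,g^*)=\min_{\tilde Q}\ \min_{Q:\,Q_Y=\tilde Q_Y,\;g^*(Q_Y,\mathsf E)\le f(Q)}\left\{D(\tilde Q_{Y|X}\|W|P_X)+I(Q)-R\right\},$$ where the double minimum is attained if it is feasible and equals $+\infty$ otherwise. -/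

import Mathlib

open Filter

noncomputable section

namespace ThresholdDecoding

/-! ### Types (empirical distributions) -/

/-- Empirical distribution of a vector `v` of length `n`. -/
def empDist {A : Type*} {n : ℕ} (v : Fin n → A) (a : A) : ℝ :=
  (Nat.card {i : Fin n // v i = a} : ℝ) / (n : ℝ)

/-- Joint empirical distribution of a pair of vectors. -/
def jointEmp {X Y : Type*} {n : ℕ} (x : Fin n → X) (y : Fin n → Y) : X × Y → ℝ :=
  empDist (fun i => (x i, y i))

open Classical in
/-- The type class of `P` at block length `n`: the vectors whose empirical distribution is `P`. -/
def typeClass {X : Type*} [Fintype X] (P : X → ℝ) (n : ℕ) : Finset (Fin n → X) :=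
  Finset.univ.filter (fun x => empDist x = P)

/-! ### Information quantities (natural logarithms) -/

/-- The `X`-marginal. -/
def margX {X Y : Type*} [Fintype Y] (Q : X × Y → ℝ) (x : X) : ℝ := ∑ y, Q (x, y)

/-- The `Y`-marginal. -/
def margY {X Y : Type*} [Fintype X] (Q : X × Y → ℝ) (y : Y) : ℝ := ∑ x, Q (x, y)

/-- The conditional distribution `Q_{Y|X}` (zero where the `X`-marginal vanishes). -/
def condYX {X Y : Type*} [Fintype Y] (Q : X × Y → ℝ) (x : X) (y : Y) : ℝ :=
  Q (x, y) / margX Q x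

/-- The joint distributions on `X × Y` with `X`-marginal `P`. -/
def jointDists {X : Type*} (Y : Type*) [Fintype X] [Fintype Y] (P : X → ℝ) :
    Set (X × Y → ℝ) :=
  {Q | Q ∈ stdSimplex ℝ (X × Y) ∧ margX Q = P}

open Classical in
/-- Information divergence, with `0 log (0/q) = 0` and `p log (p/0) = ∞` for `p > 0`. -/
def divergence {A : Type*} [Fintype A] (p q : A → ℝ) : EReal :=
  ∑ a, if p a = 0 then 0 else if q a = 0 then ⊤ else ((p a * Real.log (p a / q a) : ℝ) : EReal)

/-- Conditional divergence `D(Q_{Y|X} ‖ W | P)`. -/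
def condDivergence {X Y : Type*} [Fintype X] [Fintype Y] (W : X → Y → ℝ) (P : X → ℝ)
    (Q : X × Y → ℝ) : EReal :=
  ∑ x, (P x : EReal) * divergence (condYX Q x) (W x)

/-- Mutual information of a joint distribution (terms with `Q (x, y) = 0` vanish). -/
def mutualInfo {X Y : Type*} [Fintype X] [Fintype Y] (Q : X × Y → ℝ) : ℝ :=
  ∑ x, ∑ y, Q (x, y) * Real.log (Q (x, y) / (margX Q x * margY Q y))

/-- The normalized log-likelihood `f(Q) = ∑ Q(x,y) log W(y|x)`, with `0 log 0 = 0` and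
`q log 0 = -∞` for `q > 0`. -/
def logLik {X Y : Type*} [Fintype X] [Fintype Y] (W : X → Y → ℝ) (Q : X × Y → ℝ) : EReal :=
  ∑ x, ∑ y, (Q (x, y) : EReal) * ENNReal.log (ENNReal.ofReal (W x y))

/-! ### Codes, decoders, error probability and list size -/

/-- Memoryless channel law `P(y | x)`. -/
def channelProb {X Y : Type*} (W : X → Y → ℝ) {n : ℕ} (x : Fin n → X) (y : Fin n → Y) : ℝ :=
  ∏ i, W (x i) (y i)

/-- An erasure/list decoder: it maps an output vector to a set of messages. -/
abbrev ListDecoder (Y : Type*) (n M : ℕ) := (Fin n → Y) → Set (Fin M)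

/-- A decoding rule assigns an erasure/list decoder to each codebook, for all block lengths `n`
and all numbers `M` of codewords. -/
abbrev DecodingRule (X Y : Type*) := (n M : ℕ) → (Fin M → Fin n → X) → ListDecoder Y n M

open Classical in
/-- The average error probability `P_e(C, φ)`. -/
def errorProb {X Y : Type*} [Fintype Y] (W : X → Y → ℝ) {n M : ℕ}
    (C : Fin M → Fin n → X) (φ : ListDecoder Y n M) : ℝ :=
  (1 / (M : ℝ)) * ∑ m, ∑ y, if m ∈ φ y then 0 else channelProb W (C m) y

open Classical in
/-- The average number `L(C, φ)` of erroneous codewords on the list. -/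
def listSize {X Y : Type*} [Fintype Y] (W : X → Y → ℝ) {n M : ℕ}
    (C : Fin M → Fin n → X) (φ : ListDecoder Y n M) : ℝ :=
  ∑ y, (1 / (M : ℝ)) * ∑ m, channelProb W (C m) y *
    ∑ l, if l ≠ m ∧ l ∈ φ y then 1 else 0

/-- The number `M = e^{nR}` of codewords, rounded up to an integer. -/
def numCodewords (R : ℝ) (n : ℕ) : ℕ := ⌈Real.exp (n * R)⌉₊

/-- Average over the fixed composition ensemble: the `M` codewords are independent and uniform
on the type class of `P`, i.e. the codebook is uniform on the `M`-th power of the type class. -/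
def ensembleAvg {X : Type*} [Fintype X] (P : X → ℝ) (n M : ℕ)
    (F : (Fin M → Fin n → X) → ℝ) : ℝ :=
  (∑ C ∈ Fintype.piFinset (fun _ : Fin M => typeClass P n), F C) /
    ((Fintype.piFinset (fun _ : Fin M => typeClass P n)).card : ℝ)

/-- `liminf -(1/n) log a_n`, along the block lengths at which the type class of `P` is nonempty;
here `-log 0 = ∞`. -/
def exponent {X : Type*} [Fintype X] (P : X → ℝ) (a : ℕ → ℝ) : EReal :=
  liminf (fun n : ℕ => (-ENNReal.log (ENNReal.ofReal (a n))) / ((n : ℝ) : EReal))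
    (atTop ⊓ 𝓟 {n : ℕ | (typeClass P n).Nonempty})

/-- The random coding error exponent `E_e(R, φ)`. -/
def errorExponent {X Y : Type*} [Fintype X] [Fintype Y] (W : X → Y → ℝ) (P : X → ℝ) (R : ℝ)
    (φ : DecodingRule X Y) : EReal :=
  exponent P (fun n => ensembleAvg P n (numCodewords R n) (fun C => errorProb W C (φ n _ C)))

/-- The random coding list size exponent `E_l(R, φ)`. -/
def listExponent {X Y : Type*} [Fintype X] [Fintype Y] (W : X → Y → ℝ) (P : X → ℝ) (R : ℝ)
    (φ : DecodingRule X Y) : EReal :=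
  exponent P (fun n => ensembleAvg P n (numCodewords R n) (fun C => listSize W C (φ n _ C)))

/-! ### Thresholds that depend on the output type only -/

/-- Threshold functions of the class `Λ₁`: real and continuous on some compact set `G` of
distributions on `Y`, and `+∞` at all other distributions. Values of `g` at arguments that are
not probability distributions play no role. -/
def IsOutputThreshold {Y : Type*} [Fintype Y] (g : (Y → ℝ) → EReal) : Prop :=
  ∃ G : Set (Y → ℝ), G ⊆ stdSimplex ℝ Y ∧ IsCompact G ∧
    ContinuousOn g G ∧ (∀ q ∈ G, g q ≠ ⊤ ∧ g q ≠ ⊥) ∧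
    ∀ q ∈ stdSimplex ℝ Y, q ∉ G → g q = ⊤

/-- The decoder `φ_g`: message `m` is on the list iff the log-likelihood of the joint type of
`(x_m, y)` is at least `g` of the type of `y`. -/
def outputDecoder {X Y : Type*} [Fintype X] [Fintype Y] (W : X → Y → ℝ) (g : (Y → ℝ) → EReal) :
    DecodingRule X Y :=
  fun _ _ C y => {m | g (empDist y) ≤ logLik W (jointEmp (C m) y)}

/-- `g` is an optimal threshold function for the class `Λ₁` at rate `R` and target error
exponent `E`. -/
def IsOptimalOutputThreshold {X Y : Type*} [Fintype X] [Fintype Y] (W : X → Y → ℝ) (P : X → ℝ)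
    (R E : ℝ) (g : (Y → ℝ) → EReal) : Prop :=
  IsOutputThreshold g ∧
  (E : EReal) ≤ errorExponent W P R (outputDecoder W g) ∧
  ∀ g' : (Y → ℝ) → EReal, IsOutputThreshold g' →
    (E : EReal) ≤ errorExponent W P R (outputDecoder W g') →
    listExponent W P R (outputDecoder W g') ≤ listExponent W P R (outputDecoder W g)

/-- The feasible set in the definition of `g*(q, E)`. -/
def gStarFeasible {X Y : Type*} [Fintype X] [Fintype Y] (W : X → Y → ℝ) (P : X → ℝ) (E : ℝ)
    (q : Y → ℝ) : Set (X × Y → ℝ) :=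
  {Q | Q ∈ jointDists Y P ∧ margY Q = q ∧ condDivergence W P Q ≤ (E : EReal)}

/-- `g*(q, E)`, the minimum of `f` over the feasible set (`+∞` if there is no feasible point). -/
def gStar {X Y : Type*} [Fintype X] [Fintype Y] (W : X → Y → ℝ) (P : X → ℝ) (E : ℝ)
    (q : Y → ℝ) : EReal :=
  ⨅ Q ∈ gStarFeasible W P E q, logLik W Q

/-- The range of the inner minimization over `Q` in the list size exponent, for given `Qt`. -/
def listFeasible {X Y : Type*} [Fintype X] [Fintype Y] (W : X → Y → ℝ) (P : X → ℝ)
    (g : (Y → ℝ) → EReal) (Qt : X × Y → ℝ) : Set (X × Y → ℝ) :=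
  {Q | Q ∈ jointDists Y P ∧ margY Q = margY Qt ∧ g (margY Q) ≤ logLik W Q}

/-- The objective `D(Qt_{Y|X} ‖ W | P) + I(Q) - R`. -/
def listObjective {X Y : Type*} [Fintype X] [Fintype Y] (W : X → Y → ℝ) (P : X → ℝ) (R : ℝ)
    (Qt Q : X × Y → ℝ) : EReal :=
  condDivergence W P Qt + ((mutualInfo Q - R : ℝ) : EReal)

end ThresholdDecoding

end

set_option linter.unusedSectionVars false

namespace ThresholdDecoding

/-! By the method of types, up to factors polynomial in `n`, a sent codeword produces the joint type
`Q` with probability `exp(-n D(Q))`, while an independent codeword has joint type `Q` with a given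
output of type `Q_Y` with probability `exp(-n I(Q))`. So the average error probability is governed
by the least divergence of a joint type below threshold (`sum_missProb_le`, `le_sum_missProb`), and
the average list size by the least `D(Qt) + I(Q) - R` over pairs with a common output type in which
`Q` passes (`sum_outputProb_mul_passFraction_le`, `le_sum_outputProb_mul_passFraction`). An error
exponent of at least `E` then essentially says that `g(Q_Y) ≤ f(Q)` whenever `D(Q) < E`. The largest
threshold with this property for all `D(Q) ≤ E` is `g*`, and a larger threshold admits fewer `Q`.

The delicate half is the converse, `listExponent_le_of_le_errorExponent`: the error exponent
constrains a competing threshold only at rational `Q`, which are types for infinitely many `n`, and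
only for `D(Q) < E`. A triple `(Qt, Q, Q')`, with `Q'` witnessing `g*(Q_Y) ≤ f(Q)`, is therefore
first mixed slightly with distributions near the channel law, which makes `D(Q') < E`, and then
rounded by a `ℚ`-linear map `ℝ → ℚ` close to the identity on its entries, which keeps the marginals
equal (`exists_rational_triple`). A tie `f(Q') = f(Q)` need not survive the rounding, since
logarithms of `W` are not rational coefficients. By `exists_smaller_or_logLik_determined` the mixing
can make the inequality strict, unless `f` depends on the output marginal alone, and then the tie
survives automatically.

Strict convexity of the divergence gives the continuity of `g*`; compactness gives the attained
minima. Since `D ≥ 0`, any witness forces `E ≥ 0`, and `E ≠ 0` then leaves the strict room `E > 0`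
that the mixing needs. -/

open Real in
/-- Shannon entropy (in nats) of a vector of masses. -/
noncomputable def entropy {A : Type*} [Fintype A] (p : A → ℝ) : ℝ := ∑ a, negMulLog (p a)

/-- The log-likelihood with `log 0 = 0`: a linear functional that agrees with `logLik` on
distributions supported where `W` is positive. -/
noncomputable def realLogLik {X Y : Type*} [Fintype X] [Fintype Y] (W : X → Y → ℝ)
    (Q : X × Y → ℝ) : ℝ := ∑ x, ∑ y, Q (x, y) * Real.log (W x y)

/-- `Q` vanishes wherever `W` does. -/
def SupportedOn {X Y : Type*} (W : X → Y → ℝ) (Q : X × Y → ℝ) : Prop :=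
  ∀ x y, W x y = 0 → Q (x, y) = 0

/-- The conditional divergence, as a real number, of a distribution supported where `W` is
positive. -/
noncomputable def realCondDiv {X Y : Type*} [Fintype X] [Fintype Y] (W : X → Y → ℝ) (P : X → ℝ)
    (Q : X × Y → ℝ) : ℝ := entropy P - entropy Q - realLogLik W Q

/-! ### Entropy formulas for the information quantities, infinite values, convexity. -/

section Formulas

variable {X Y : Type*} [Fintype X] [Fintype Y]

theorem margX_nonneg {Q : X × Y → ℝ} (hQ : ∀ z, 0 ≤ Q z) (x : X) : 0 ≤ margX Q x :=
  Finset.sum_nonneg fun _ _ => hQ _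

theorem margY_nonneg {Q : X × Y → ℝ} (hQ : ∀ z, 0 ≤ Q z) (y : Y) : 0 ≤ margY Q y :=
  Finset.sum_nonneg fun _ _ => hQ _

theorem le_margX {Q : X × Y → ℝ} (hQ : ∀ z, 0 ≤ Q z) (x : X) (y : Y) : Q (x, y) ≤ margX Q x :=
  Finset.single_le_sum (f := fun y => Q (x, y)) (fun _ _ => hQ _) (Finset.mem_univ y)

theorem le_margY {Q : X × Y → ℝ} (hQ : ∀ z, 0 ≤ Q z) (x : X) (y : Y) : Q (x, y) ≤ margY Q y :=
  Finset.single_le_sum (f := fun x => Q (x, y)) (fun _ _ => hQ _) (Finset.mem_univ x)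

theorem margY_mem_stdSimplex {Q : X × Y → ℝ} (hQ : Q ∈ stdSimplex ℝ (X × Y)) :
    margY Q ∈ stdSimplex ℝ Y := by
  refine ⟨margY_nonneg hQ.1, ?_⟩
  rw [← hQ.2, Fintype.sum_prod_type_right]
  rfl

theorem entropy_eq_sum_sum (Q : X × Y → ℝ) :
    entropy Q = -∑ x, ∑ y, Q (x, y) * Real.log (Q (x, y)) := by
  rw [entropy, Fintype.sum_prod_type, ← Finset.sum_neg_distrib]
  refine Finset.sum_congr rfl fun x _ => ?_
  rw [← Finset.sum_neg_distrib]
  exact Finset.sum_congr rfl fun y _ => by rw [Real.negMulLog]; ring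

theorem sum_mul_log_margX (Q : X × Y → ℝ) :
    ∑ x, ∑ y, Q (x, y) * Real.log (margX Q x) = -entropy (margX Q) := by
  rw [entropy, ← Finset.sum_neg_distrib]
  refine Finset.sum_congr rfl fun x _ => ?_
  rw [← Finset.sum_mul, Real.negMulLog]
  change margX Q x * _ = _
  ring

theorem sum_mul_log_margY (Q : X × Y → ℝ) :
    ∑ x, ∑ y, Q (x, y) * Real.log (margY Q y) = -entropy (margY Q) := by
  rw [entropy, ← Finset.sum_neg_distrib, Finset.sum_comm]
  refine Finset.sum_congr rfl fun y _ => ?_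
  rw [← Finset.sum_mul, Real.negMulLog]
  change margY Q y * _ = _
  ring

/-- The logarithm splits term by term because a positive entry forces both of its marginals to be
positive. The entropic form is continuous everywhere. -/
theorem mutualInfo_eq {Q : X × Y → ℝ} (hQ : ∀ z, 0 ≤ Q z) :
    mutualInfo Q = entropy (margX Q) + entropy (margY Q) - entropy Q := by
  have h : ∀ x y, Q (x, y) * Real.log (Q (x, y) / (margX Q x * margY Q y)) =
      Q (x, y) * Real.log (Q (x, y)) - Q (x, y) * Real.log (margX Q x)
        - Q (x, y) * Real.log (margY Q y) := by
    intro x y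
    rcases (hQ (x, y)).eq_or_lt with h0 | h0
    · simp [← h0]
    · have hx := h0.trans_le (le_margX hQ x y)
      have hy := h0.trans_le (le_margY hQ x y)
      rw [Real.log_div h0.ne' (mul_pos hx hy).ne', Real.log_mul hx.ne' hy.ne']
      ring
  simp only [mutualInfo, h, Finset.sum_sub_distrib, sum_mul_log_margX, sum_mul_log_margY,
    entropy_eq_sum_sum]
  ring

/-- In `EReal`, `⊥ + ⊤ = ⊥`: an infinite term decides the sum only once `⊥` is excluded. The
companion for `⊥` needs no such condition. -/
theorem sum_eq_top_of_mem {ι : Type*} {s : Finset ι} {f : ι → EReal} (hf : ∀ i ∈ s, f i ≠ ⊥)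
    {i : ι} (hi : i ∈ s) (h : f i = ⊤) : ∑ j ∈ s, f j = ⊤ := by
  classical
  rw [← Finset.add_sum_erase s f hi, h]
  refine EReal.top_add_of_ne_bot ?_
  have : ∀ t : Finset ι, (∀ j ∈ t, f j ≠ ⊥) → ∑ j ∈ t, f j ≠ ⊥ := by
    intro t
    induction t using Finset.induction_on with
    | empty => simp
    | insert a t ha ih =>
      intro ht
      rw [Finset.sum_insert ha]
      exact (EReal.add_ne_bot_iff).2
        ⟨ht a (Finset.mem_insert_self a t), ih fun j hj => ht j (Finset.mem_insert_of_mem hj)⟩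
  exact this _ fun j hj => hf j (Finset.mem_of_mem_erase hj)

theorem sum_eq_bot_of_mem {ι : Type*} {s : Finset ι} {f : ι → EReal}
    {i : ι} (hi : i ∈ s) (h : f i = ⊥) : ∑ j ∈ s, f j = ⊥ := by
  classical
  rw [← Finset.add_sum_erase s f hi, h, EReal.bot_add]

theorem coe_sum {ι : Type*} (s : Finset ι) (f : ι → ℝ) :
    ((∑ i ∈ s, f i : ℝ) : EReal) = ∑ i ∈ s, (f i : EReal) := by
  classical
  induction s using Finset.induction_on with
  | empty => simp
  | insert a s ha ih => rw [Finset.sum_insert ha, Finset.sum_insert ha, EReal.coe_add, ih]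

theorem log_ofReal_of_pos {w : ℝ} (hw : 0 < w) :
    ENNReal.log (ENNReal.ofReal w) = (Real.log w : EReal) := by
  rw [ENNReal.log_pos_real (by simpa using hw) ENNReal.ofReal_ne_top, ENNReal.toReal_ofReal hw.le]

theorem logLik_eq_realLogLik {W : X → Y → ℝ} (hW : ∀ x y, 0 ≤ W x y) {Q : X × Y → ℝ}
    (hS : SupportedOn W Q) : logLik W Q = (realLogLik W Q : EReal) := by
  rw [logLik, realLogLik, coe_sum]
  refine Finset.sum_congr rfl fun x _ => ?_
  rw [coe_sum]
  refine Finset.sum_congr rfl fun y _ => ?_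
  rcases (hW x y).eq_or_lt with h | h
  · rw [hS x y h.symm]; simp
  · rw [log_ofReal_of_pos h, EReal.coe_mul]

theorem logLik_eq_bot {W : X → Y → ℝ} {Q : X × Y → ℝ}
    (hQ : ∀ z, 0 ≤ Q z) (hS : ¬ SupportedOn W Q) : logLik W Q = ⊥ := by
  simp only [SupportedOn, not_forall] at hS
  obtain ⟨x, y, h0, h1⟩ := hS
  refine sum_eq_bot_of_mem (Finset.mem_univ x) (sum_eq_bot_of_mem (Finset.mem_univ y) ?_)
  rw [h0, ENNReal.ofReal_zero, ENNReal.log_zero, EReal.coe_mul_bot_of_pos]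
  exact lt_of_le_of_ne (hQ _) (Ne.symm h1)

theorem divergence_ne_bot {A : Type*} [Fintype A] (p q : A → ℝ) (a : A) :
    (if p a = 0 then (0 : EReal) else if q a = 0 then ⊤ else
      ((p a * Real.log (p a / q a) : ℝ) : EReal)) ≠ ⊥ := by
  split_ifs
  exacts [EReal.zero_ne_bot, top_ne_bot, EReal.coe_ne_bot _]

theorem divergence_eq_coe {A : Type*} [Fintype A] {p q : A → ℝ} (h : ∀ a, q a = 0 → p a = 0) :
    divergence p q = ((∑ a, p a * Real.log (p a / q a) : ℝ) : EReal) := by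
  rw [divergence, coe_sum]
  refine Finset.sum_congr rfl fun a _ => ?_
  by_cases hp : p a = 0
  · simp [hp]
  · rw [if_neg hp, if_neg fun hq => hp (h a hq)]

theorem divergence_eq_top {A : Type*} [Fintype A] {p q : A → ℝ} {a : A} (hq : q a = 0)
    (hp : p a ≠ 0) : divergence p q = ⊤ := by
  refine sum_eq_top_of_mem (fun i _ => ?_) (Finset.mem_univ a) ?_
  · exact divergence_ne_bot p q i
  · rw [if_neg hp, if_pos hq]

theorem divergence_eq_top_or_coe {A : Type*} [Fintype A] (p q : A → ℝ) :
    divergence p q = ⊤ ∨ ∃ r : ℝ, divergence p q = r := by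
  by_cases h : ∀ a, q a = 0 → p a = 0
  · exact Or.inr ⟨_, divergence_eq_coe h⟩
  · push Not at h
    obtain ⟨a, h0, h1⟩ := h
    exact Or.inl (divergence_eq_top h0 h1)

/-- Splitting the logarithm leaves entropies and a linear functional, a form that is continuous on
the whole space and visibly convex. -/
theorem condDivergence_eq_coe {W : X → Y → ℝ} {P : X → ℝ}
    {Q : X × Y → ℝ} (hQ : Q ∈ jointDists Y P) (hS : SupportedOn W Q) :
    condDivergence W P Q = (realCondDiv W P Q : EReal) := by
  obtain ⟨⟨hQ0, -⟩, rfl⟩ := hQ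
  have hc : ∀ x y, W x y = 0 → condYX Q x y = 0 := fun x y h => by
    rw [condYX, hS x y h, zero_div]
  have hterm : ∀ x y, margX Q x * (condYX Q x y * Real.log (condYX Q x y / W x y)) =
      Q (x, y) * Real.log (Q (x, y)) - Q (x, y) * Real.log (margX Q x)
        - Q (x, y) * Real.log (W x y) := by
    intro x y
    rcases (hQ0 (x, y)).eq_or_lt with h0 | h0
    · simp [condYX, ← h0]
    · have hx := h0.trans_le (le_margX hQ0 x y)
      have hw : W x y ≠ 0 := fun h => h0.ne' (hS x y h)
      rw [condYX, Real.log_div (div_pos h0 hx).ne' hw, Real.log_div h0.ne' hx.ne']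
      field_simp
  have : condDivergence W (margX Q) Q =
      ((∑ x, margX Q x * ∑ y, condYX Q x y * Real.log (condYX Q x y / W x y) : ℝ) : EReal) := by
    rw [condDivergence, coe_sum]
    refine Finset.sum_congr rfl fun x _ => ?_
    rw [divergence_eq_coe (hc x), EReal.coe_mul]
  rw [this, realCondDiv, entropy_eq_sum_sum]
  congr 1
  simp only [Finset.mul_sum, hterm, Finset.sum_sub_distrib, sum_mul_log_margX, realLogLik]
  ring

theorem condDivergence_eq_top {W : X → Y → ℝ} {P : X → ℝ}
    {Q : X × Y → ℝ} (hQ : Q ∈ jointDists Y P) (hS : ¬ SupportedOn W Q) :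
    condDivergence W P Q = ⊤ := by
  obtain ⟨⟨hQ0, -⟩, rfl⟩ := hQ
  simp only [SupportedOn, not_forall] at hS
  obtain ⟨x, y, h0, h1⟩ := hS
  have hpos : 0 < Q (x, y) := lt_of_le_of_ne (hQ0 _) (Ne.symm h1)
  have hx := hpos.trans_le (le_margX hQ0 x y)
  refine sum_eq_top_of_mem (fun i _ => ?_) (Finset.mem_univ x) ?_
  -- No summand is `⊥`: an infinite divergence is weighted by a nonnegative mass, and `0 * ⊤ = 0`.
  · rcases divergence_eq_top_or_coe (condYX Q i) (W i) with h | ⟨r, h⟩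
    · rcases (margX_nonneg hQ0 i).eq_or_lt with h' | h'
      · rw [← h']; simp
      · rw [h, EReal.coe_mul_top_of_pos h']; simp
    · rw [h, ← EReal.coe_mul]; exact EReal.coe_ne_bot _
  · rw [divergence_eq_top h0 (div_pos hpos hx).ne', EReal.coe_mul_top_of_pos hx]

theorem condDivergence_le_coe_iff {W : X → Y → ℝ} {P : X → ℝ}
    {Q : X × Y → ℝ} (hQ : Q ∈ jointDists Y P) (E : ℝ) :
    condDivergence W P Q ≤ (E : EReal) ↔ SupportedOn W Q ∧ realCondDiv W P Q ≤ E := by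
  by_cases hS : SupportedOn W Q
  · simp [condDivergence_eq_coe hQ hS, hS]
  · simp [condDivergence_eq_top hQ hS, hS]

@[fun_prop]
theorem continuous_entropy {A : Type*} [Fintype A] : Continuous (entropy : (A → ℝ) → ℝ) := by
  unfold entropy
  fun_prop

@[fun_prop]
theorem continuous_margX : Continuous (margX : (X × Y → ℝ) → X → ℝ) := by
  unfold margX
  fun_prop

@[fun_prop]
theorem continuous_margY : Continuous (margY : (X × Y → ℝ) → Y → ℝ) := by
  unfold margY
  fun_prop

@[fun_prop]
theorem continuous_realLogLik (W : X → Y → ℝ) : Continuous (realLogLik W) := by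
  unfold realLogLik
  fun_prop

@[fun_prop]
theorem continuous_realCondDiv (W : X → Y → ℝ) (P : X → ℝ) : Continuous (realCondDiv W P) := by
  unfold realCondDiv
  fun_prop

theorem margX_add_smul (a b : ℝ) (Q Q' : X × Y → ℝ) :
    margX (a • Q + b • Q') = a • margX Q + b • margX Q' := by
  ext x
  simp [margX, Finset.sum_add_distrib, Finset.mul_sum]

theorem margY_add_smul (a b : ℝ) (Q Q' : X × Y → ℝ) :
    margY (a • Q + b • Q') = a • margY Q + b • margY Q' := by
  ext x
  simp [margY, Finset.sum_add_distrib, Finset.mul_sum]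

theorem realLogLik_add_smul (W : X → Y → ℝ) (a b : ℝ) (Q Q' : X × Y → ℝ) :
    realLogLik W (a • Q + b • Q') = a * realLogLik W Q + b * realLogLik W Q' := by
  simp [realLogLik, Finset.sum_add_distrib, Finset.mul_sum, add_mul, mul_assoc]

theorem SupportedOn.add_smul {W : X → Y → ℝ} {Q Q' : X × Y → ℝ} (h : SupportedOn W Q)
    (h' : SupportedOn W Q') (a b : ℝ) : SupportedOn W (a • Q + b • Q') := fun x y hw => by
  simp [h x y hw, h' x y hw]

theorem entropy_concave {A : Type*} [Fintype A] {p q : A → ℝ} (hp : ∀ a, 0 ≤ p a)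
    (hq : ∀ a, 0 ≤ q a) {a b : ℝ} (ha : 0 ≤ a) (hb : 0 ≤ b) (hab : a + b = 1) :
    a * entropy p + b * entropy q ≤ entropy (a • p + b • q) := by
  simp only [entropy, Finset.mul_sum, ← Finset.sum_add_distrib]
  exact Finset.sum_le_sum fun i _ => by
    simpa using Real.concaveOn_negMulLog.2 (hp i) (hq i) ha hb hab

theorem entropy_strictConcave {A : Type*} [Fintype A] {p q : A → ℝ} (hp : ∀ a, 0 ≤ p a)
    (hq : ∀ a, 0 ≤ q a) (hne : p ≠ q) {a b : ℝ} (ha : 0 < a) (hb : 0 < b) (hab : a + b = 1) :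
    a * entropy p + b * entropy q < entropy (a • p + b • q) := by
  simp only [entropy, Finset.mul_sum, ← Finset.sum_add_distrib]
  obtain ⟨i, hi⟩ := Function.ne_iff.1 hne
  refine Finset.sum_lt_sum (fun i _ => ?_) ⟨i, Finset.mem_univ i, ?_⟩
  · simpa using Real.concaveOn_negMulLog.2 (hp i) (hq i) ha.le hb.le hab
  · simpa using Real.strictConcaveOn_negMulLog.2 (hp i) (hq i) hi ha hb hab

theorem realCondDiv_convex (W : X → Y → ℝ) (P : X → ℝ) {p q : X × Y → ℝ} (hp : ∀ a, 0 ≤ p a)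
    (hq : ∀ a, 0 ≤ q a) {a b : ℝ} (ha : 0 ≤ a) (hb : 0 ≤ b) (hab : a + b = 1) :
    realCondDiv W P (a • p + b • q) ≤ a * realCondDiv W P p + b * realCondDiv W P q := by
  have h := entropy_concave hp hq ha hb hab
  have h2 : entropy P = (a + b) * entropy P := by rw [hab, one_mul]
  simp only [realCondDiv, realLogLik_add_smul]
  linarith

/-- The likelihood is linear, so strictness comes from the entropy. It serves the continuity of
`gStar`: a proper mixture of two points of a divergence ball lies strictly inside the ball. -/
theorem realCondDiv_strictConvex (W : X → Y → ℝ) (P : X → ℝ) {p q : X × Y → ℝ}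
    (hp : ∀ a, 0 ≤ p a) (hq : ∀ a, 0 ≤ q a) (hne : p ≠ q) {a b : ℝ} (ha : 0 < a) (hb : 0 < b)
    (hab : a + b = 1) :
    realCondDiv W P (a • p + b • q) < a * realCondDiv W P p + b * realCondDiv W P q := by
  have h := entropy_strictConcave hp hq hne ha hb hab
  have h2 : entropy P = (a + b) * entropy P := by rw [hab, one_mul]
  simp only [realCondDiv, realLogLik_add_smul]
  linarith

end Formulas

/-! ### Method of types: counting sequences of a given type. -/

section Types

variable {A X Y : Type*} [Fintype A] [Fintype X] [Fintype Y] {n : ℕ}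

theorem mem_typeClass {p : A → ℝ} {v : Fin n → A} : v ∈ typeClass p n ↔ empDist v = p := by
  simp [typeClass]

theorem sum_comp_eq_sum_card_mul (v : Fin n → A) (g : A → ℝ) :
    ∑ i, g (v i) = ∑ a, (Nat.card {i : Fin n // v i = a} : ℝ) * g a := by
  classical
  rw [← Finset.sum_fiberwise Finset.univ v]
  refine Finset.sum_congr rfl fun a _ => ?_
  rw [Finset.sum_congr rfl (g := fun _ => g a) fun i hi => by rw [(Finset.mem_filter.1 hi).2],
    Finset.sum_const, nsmul_eq_mul, Nat.card_eq_fintype_card, Fintype.card_subtype]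

theorem sum_comp_eq (hn : n ≠ 0) (v : Fin n → A) (g : A → ℝ) :
    ∑ i, g (v i) = n * ∑ a, empDist v a * g a := by
  rw [sum_comp_eq_sum_card_mul, Finset.mul_sum]
  refine Finset.sum_congr rfl fun a _ => ?_
  have : (n : ℝ) ≠ 0 := by exact_mod_cast hn
  rw [empDist]
  field_simp

theorem sum_card_fiber (v : Fin n → A) : ∑ a, Nat.card {i : Fin n // v i = a} = n := by
  have h := sum_comp_eq_sum_card_mul v (fun _ => 1)
  simp only [Finset.sum_const, Finset.card_univ, Fintype.card_fin, nsmul_eq_mul, mul_one] at h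
  exact_mod_cast h.symm

theorem empDist_nonneg (v : Fin n → A) (a : A) : 0 ≤ empDist v a := by
  unfold empDist; positivity

theorem empDist_mem_stdSimplex (hn : n ≠ 0) (v : Fin n → A) : empDist v ∈ stdSimplex ℝ A := by
  refine ⟨empDist_nonneg v, ?_⟩
  have : (n : ℝ) ≠ 0 := by exact_mod_cast hn
  simp only [empDist, ← Finset.sum_div]
  rw [← Nat.cast_sum, sum_card_fiber, div_self this]

theorem empDist_comp_perm (v : Fin n → A) (σ : Equiv.Perm (Fin n)) :
    empDist (v ∘ σ) = empDist v := by
  ext a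
  unfold empDist
  congr 2
  exact Nat.card_congr (σ.subtypeEquiv fun _ => Iff.rfl)

theorem card_fiber_eq_of_empDist_eq {v w : Fin n → A} (h : empDist v = empDist w) (a : A) :
    Nat.card {i : Fin n // v i = a} = Nat.card {i : Fin n // w i = a} := by
  rcases Nat.eq_zero_or_pos n with rfl | hn
  · simp
  · have := congrFun h a
    have hn' : (n : ℝ) ≠ 0 := by exact_mod_cast hn.ne'
    rw [empDist, empDist, div_left_inj' hn'] at this
    exact_mod_cast this

/-- Equal types mean fibres of equal size; bijections between corresponding fibres glue to a
permutation of the positions. -/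
theorem exists_perm_of_empDist_eq {v w : Fin n → A} (h : empDist v = empDist w) :
    ∃ σ : Equiv.Perm (Fin n), v ∘ σ = w := by
  have e : ∀ a, Nonempty ({i : Fin n // w i = a} ≃ {i : Fin n // v i = a}) := fun a =>
    Finite.card_eq.1 (card_fiber_eq_of_empDist_eq h a).symm
  replace e := fun a => (e a).some
  refine ⟨(Equiv.sigmaFiberEquiv w).symm.trans
    ((Equiv.sigmaCongrRight e).trans (Equiv.sigmaFiberEquiv v)), ?_⟩
  ext i
  exact (e (w i) ⟨i, rfl⟩).2

theorem exists_empDist_eq (k : A → ℕ) (hk : ∑ a, k a = n) :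
    ∃ v : Fin n → A, ∀ a, empDist v a = k a / n := by
  have e : Fin n ≃ Σ a, Fin (k a) := Fintype.equivOfCardEq (by simp [hk])
  refine ⟨fun i => (e i).1, fun a => ?_⟩
  have : Nat.card {i : Fin n // (e i).1 = a} = k a := by
    rw [Nat.card_congr (e.subtypeEquiv (q := fun s => s.1 = a) fun _ => Iff.rfl),
      Nat.card_congr (Equiv.sigmaSubtype a), Nat.card_fin]
  rw [empDist, this]

/-- Orbit counting: the type class is the orbit of `v` under permutations of the positions, and its
stabilizer permutes each fibre separately. -/
theorem card_typeClass_mul_prod_factorial (v : Fin n → A) :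
    (typeClass (empDist v) n).card * ∏ a, (Nat.card {i : Fin n // v i = a}).factorial =
      n.factorial := by
  classical
  have hperm : n.factorial = (Finset.univ : Finset (Equiv.Perm (Fin n))).card := by
    rw [Finset.card_univ, Fintype.card_perm, Fintype.card_fin]
  rw [hperm, Finset.card_eq_sum_card_fiberwise (f := fun σ : Equiv.Perm (Fin n) => v ∘ σ)
    (t := typeClass (empDist v) n)
    (fun σ _ => by
      rw [Finset.mem_coe, mem_typeClass]
      exact empDist_comp_perm v σ), Finset.sum_const_nat]
  intro w hw
  obtain ⟨τ, rfl⟩ := exists_perm_of_empDist_eq (mem_typeClass.1 hw).symm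
  have hs := DomMulAct.stabilizer_card v
  simp only [Nat.card_eq_fintype_card]
  rw [← hs, ← Fintype.card_subtype]
  -- The permutations that send `v` to `v ∘ τ` form a coset of the stabilizer of `v`.
  refine Fintype.card_congr ((Equiv.mulRight τ⁻¹).subtypeEquiv fun σ => ?_)
  constructor
  · intro h
    ext i
    have := congrFun h (τ⁻¹ i)
    simpa using this
  · intro h
    ext i
    have := congrFun h (τ i)
    simpa using this

/-- A crude Stirling bound; the inductive step is `log u ≤ u - 1` at `u = (k + 1) / k`. The matching
upper bound uses `u = k / (k + 1)`. Both hold at `k = 0` because `Real.log 0 = 0`. -/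
theorem log_factorial_ge (k : ℕ) : k * Real.log k - k ≤ Real.log k.factorial := by
  induction k with
  | zero => simp
  | succ k ih =>
    rw [Nat.factorial_succ, Nat.cast_mul,
      Real.log_mul (by positivity) (by positivity)]
    rcases Nat.eq_zero_or_pos k with rfl | hk
    · simp
    have hk' : (0 : ℝ) < k := by exact_mod_cast hk
    have h : Real.log (((k : ℝ) + 1) / k) ≤ ((k : ℝ) + 1) / k - 1 :=
      Real.log_le_sub_one_of_pos (by positivity)
    rw [Real.log_div (by positivity) (by positivity)] at h
    have h2 : (k : ℝ) * (Real.log (k + 1) - Real.log k) ≤ k * (((k : ℝ) + 1) / k - 1) :=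
      mul_le_mul_of_nonneg_left h hk'.le
    have h3 : (k : ℝ) * (((k : ℝ) + 1) / k - 1) = 1 := by field_simp; ring
    push_cast
    nlinarith

theorem log_factorial_le (k : ℕ) :
    Real.log k.factorial ≤ k * Real.log k - k + 1 + Real.log k := by
  induction k with
  | zero => simp
  | succ k ih =>
    rw [Nat.factorial_succ, Nat.cast_mul,
      Real.log_mul (by positivity) (by positivity)]
    rcases Nat.eq_zero_or_pos k with rfl | hk
    · simp
    have hk' : (0 : ℝ) < k := by exact_mod_cast hk
    have h : Real.log ((k : ℝ) / (k + 1)) ≤ (k : ℝ) / (k + 1) - 1 :=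
      Real.log_le_sub_one_of_pos (by positivity)
    rw [Real.log_div (by positivity) (by positivity)] at h
    have h2 : ((k : ℝ) + 1) * (Real.log k - Real.log (k + 1)) ≤ (k + 1) * ((k : ℝ) / (k + 1) - 1) :=
      mul_le_mul_of_nonneg_left h (by positivity)
    have h3 : ((k : ℝ) + 1) * ((k : ℝ) / (k + 1) - 1) = -1 := by field_simp; ring
    push_cast
    nlinarith

/-- The size of a type class, up to a polynomial factor. -/
theorem abs_log_card_typeClass_sub_le (hn : n ≠ 0) (v : Fin n → A) :
    |Real.log (typeClass (empDist v) n).card - n * entropy (empDist v)| ≤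
      (Fintype.card A + 1) * (1 + Real.log (n + 1)) := by
  have hn' : (0 : ℝ) < n := by exact_mod_cast Nat.pos_of_ne_zero hn
  set k : A → ℕ := fun a => Nat.card {i : Fin n // v i = a} with hk
  have hsum : ∑ a, (k a : ℝ) = n := by exact_mod_cast sum_card_fiber v
  have hpos : 0 < (typeClass (empDist v) n).card :=
    Finset.card_pos.2 ⟨v, mem_typeClass.2 rfl⟩
  have hlog : Real.log (typeClass (empDist v) n).card =
      Real.log n.factorial - ∑ a, Real.log (k a).factorial := by
    rw [← card_typeClass_mul_prod_factorial v, Nat.cast_mul, Real.log_mul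
      (by exact_mod_cast hpos.ne')
      (by exact_mod_cast (Finset.prod_pos fun a _ => Nat.factorial_pos _).ne'), Nat.cast_prod,
      Real.log_prod (fun a _ => by exact_mod_cast Nat.factorial_ne_zero _)]
    ring
  have hent : n * entropy (empDist v) = n * Real.log n - ∑ a, k a * Real.log (k a) := by
    have h1 : n * Real.log n = ∑ a, (k a : ℝ) * Real.log n := by rw [← Finset.sum_mul, hsum]
    rw [h1, ← Finset.sum_sub_distrib, entropy, Finset.mul_sum]
    refine Finset.sum_congr rfl fun a _ => ?_
    change (n : ℝ) * Real.negMulLog ((k a : ℝ) / n) = _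
    rcases Nat.eq_zero_or_pos (k a) with h | h
    · simp [h]
    · have : (0 : ℝ) < k a := by exact_mod_cast h
      rw [Real.negMulLog, Real.log_div this.ne' hn'.ne']
      field_simp
      ring
  have hL : 0 ≤ Real.log (n + 1 : ℝ) := Real.log_nonneg (by linarith)
  have hnlog : Real.log (n : ℝ) ≤ Real.log (n + 1) := Real.log_le_log hn' (by linarith)
  have hkn : ∀ a, Real.log (k a) ≤ Real.log (n + 1) := by
    intro a
    rcases Nat.eq_zero_or_pos (k a) with h | h
    · simpa [h] using hL
    · refine Real.log_le_log (by exact_mod_cast h) ?_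
      have h1 : (k a : ℝ) ≤ ∑ b, (k b : ℝ) :=
        Finset.single_le_sum (f := fun b => (k b : ℝ)) (fun _ _ => by positivity)
          (Finset.mem_univ a)
      linarith
  -- The linear Stirling terms `-k a` add up to `-n` and cancel the one from `n!`, so only the
  -- entropy and logarithmic errors remain.
  have hlow : ∑ a, ((k a : ℝ) * Real.log (k a) - k a) ≤ ∑ a, Real.log (k a).factorial :=
    Finset.sum_le_sum fun a _ => log_factorial_ge _
  have hup : ∑ a, Real.log (k a).factorial ≤
      ∑ a, ((k a : ℝ) * Real.log (k a) - k a + (1 + Real.log (n + 1))) :=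
    Finset.sum_le_sum fun a _ => by linarith [log_factorial_le (k a), hkn a]
  simp only [Finset.sum_sub_distrib, Finset.sum_add_distrib, hsum, Finset.sum_const,
    Finset.card_univ, nsmul_eq_mul] at hlow hup
  have h1 := log_factorial_ge n
  have h2 := log_factorial_le n
  have hc : (0 : ℝ) ≤ Fintype.card A * (1 + Real.log (n + 1)) := by positivity
  rw [hlog, hent, abs_le]
  constructor
  · nlinarith
  · nlinarith

/-- There are only polynomially many types. -/
theorem card_image_empDist_le [DecidableEq (A → ℝ)] :
    ((Finset.univ : Finset (Fin n → A)).image empDist).card ≤ (n + 1) ^ Fintype.card A := by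
  classical
  have hlt : ∀ (v : Fin n → A) a, Nat.card {i : Fin n // v i = a} < n + 1 := fun v a => by
    refine Nat.lt_succ_of_le ((Finite.card_subtype_le _).trans ?_)
    simp
  let c : (Fin n → A) → A → Fin (n + 1) := fun v a => ⟨_, hlt v a⟩
  let d : (A → Fin (n + 1)) → A → ℝ := fun k a => (k a : ℕ) / (n : ℝ)
  have hd : (empDist : (Fin n → A) → A → ℝ) = d ∘ c := by
    ext v a
    rfl
  rw [hd, ← Finset.image_image]
  refine Finset.card_image_le.trans ((Finset.card_le_univ _).trans ?_)
  simp

theorem margX_empDist (z : Fin n → X × Y) : margX (empDist z) = empDist (fun i => (z i).1) := by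
  classical
  ext x
  simp only [margX, empDist, ← Finset.sum_div, Nat.card_eq_fintype_card, Fintype.card_subtype]
  congr 1
  rw [← Nat.cast_sum, Finset.card_eq_sum_card_fiberwise (s := Finset.univ.filter _)
    (f := fun i => (z i).2) (t := Finset.univ) (fun _ _ => by simp)]
  simp only [Finset.filter_filter, Prod.ext_iff]

theorem margY_empDist (z : Fin n → X × Y) : margY (empDist z) = empDist (fun i => (z i).2) := by
  classical
  ext y
  simp only [margY, empDist, ← Finset.sum_div, Nat.card_eq_fintype_card, Fintype.card_subtype]
  congr 1
  rw [← Nat.cast_sum, Finset.card_eq_sum_card_fiberwise (s := Finset.univ.filter _)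
    (f := fun i => (z i).1) (t := Finset.univ) (fun _ _ => by simp)]
  simp only [Finset.filter_filter, Prod.ext_iff, and_comm]

theorem margX_jointEmp (x : Fin n → X) (y : Fin n → Y) : margX (jointEmp x y) = empDist x :=
  margX_empDist _

theorem margY_jointEmp (x : Fin n → X) (y : Fin n → Y) : margY (jointEmp x y) = empDist y :=
  margY_empDist _

theorem jointEmp_comp_perm (x : Fin n → X) (y : Fin n → Y) (σ : Equiv.Perm (Fin n)) :
    jointEmp (x ∘ σ) (y ∘ σ) = jointEmp x y :=
  empDist_comp_perm (fun i => (x i, y i)) σ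

open Classical in
/-- The number of `x` that have joint type `Q` with `y`. -/
noncomputable def jointCount (Q : X × Y → ℝ) (y : Fin n → Y) : ℕ :=
  (Finset.univ.filter fun x : Fin n → X => jointEmp x y = Q).card

theorem jointCount_comp_perm (Q : X × Y → ℝ) (y : Fin n → Y) (σ : Equiv.Perm (Fin n)) :
    jointCount Q (y ∘ σ) = jointCount Q y := by
  classical
  unfold jointCount
  symm
  refine Finset.card_equiv (Equiv.arrowCongr σ.symm (Equiv.refl X)) fun x => ?_
  have : (Equiv.arrowCongr σ.symm (Equiv.refl X)) x = x ∘ σ := by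
    ext i; simp [Equiv.arrowCongr]
  rw [Finset.mem_filter, Finset.mem_filter, this, jointEmp_comp_perm]
  simp

theorem sum_jointCount (Q : X × Y → ℝ) :
    ∑ y : Fin n → Y, jointCount Q y = (typeClass Q n).card := by
  classical
  rw [Finset.card_eq_sum_card_fiberwise (s := typeClass Q n)
    (f := fun z i => (z i).2) (t := Finset.univ) (fun _ _ => by simp)]
  refine Finset.sum_congr rfl fun y _ => ?_
  unfold jointCount
  refine Finset.card_bij' (fun x _ i => (x i, y i)) (fun z _ i => (z i).1) ?_ ?_ ?_ ?_
  · intro x hx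
    simp only [Finset.mem_filter, mem_typeClass, Finset.mem_univ, true_and] at hx ⊢
    exact ⟨hx, trivial⟩
  · intro z hz
    simp only [Finset.mem_filter, mem_typeClass, Finset.mem_univ, true_and] at hz ⊢
    obtain ⟨h1, rfl⟩ := hz
    exact h1
  · intro x hx
    rfl
  · intro z hz
    simp only [Finset.mem_filter] at hz
    obtain ⟨h1, rfl⟩ := hz
    rfl

/-- Type class symmetry: every `y` of the type `margY Q` has equally many `x` with joint type
`Q`. -/
theorem jointCount_mul_card_typeClass {Q : X × Y → ℝ} {y : Fin n → Y} (hy : empDist y = margY Q) :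
    jointCount Q y * (typeClass (margY Q) n).card = (typeClass Q n).card := by
  classical
  rw [← sum_jointCount, ← Finset.sum_subset (Finset.subset_univ (typeClass (margY Q) n)),
    Finset.sum_const_nat (m := jointCount Q y), mul_comm]
  · intro y' hy'
    obtain ⟨σ, rfl⟩ := exists_perm_of_empDist_eq (hy.trans (mem_typeClass.1 hy').symm)
    exact jointCount_comp_perm Q y σ
  · intro y' _ hy'
    unfold jointCount
    rw [Finset.card_eq_zero, Finset.filter_eq_empty_iff]
    intro x _ hx
    exact hy' (mem_typeClass.2 (by rw [← hx, margY_jointEmp]))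

theorem channelProb_nonneg {W : X → Y → ℝ} (hW : ∀ x y, 0 ≤ W x y) (x : Fin n → X)
    (y : Fin n → Y) : 0 ≤ channelProb W x y :=
  Finset.prod_nonneg fun _ _ => hW _ _

theorem channelProb_eq_exp (hn : n ≠ 0) {W : X → Y → ℝ} (hW : ∀ x y, 0 ≤ W x y)
    {x : Fin n → X} {y : Fin n → Y} (hS : SupportedOn W (jointEmp x y)) :
    channelProb W x y = Real.exp (n * realLogLik W (jointEmp x y)) := by
  have hpos : ∀ i, 0 < W (x i) (y i) := by
    intro i
    refine lt_of_le_of_ne (hW _ _) fun h => ?_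
    have h0 := hS _ _ h.symm
    have hn' : (n : ℝ) ≠ 0 := by exact_mod_cast hn
    have : Nonempty {j : Fin n // (x j, y j) = (x i, y i)} := ⟨⟨i, rfl⟩⟩
    rw [jointEmp, empDist, div_eq_zero_iff, or_iff_left hn', Nat.cast_eq_zero] at h0
    exact Nat.card_pos.ne' h0
  rw [channelProb, ← Real.exp_log (Finset.prod_pos fun i _ => hpos i),
    Real.log_prod fun i _ => (hpos i).ne',
    sum_comp_eq hn (fun i => (x i, y i)) (fun z => Real.log (W z.1 z.2)), realLogLik,
    Fintype.sum_prod_type]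
  rfl

theorem channelProb_eq_zero {W : X → Y → ℝ}
    {x : Fin n → X} {y : Fin n → Y} (hS : ¬ SupportedOn W (jointEmp x y)) :
    channelProb W x y = 0 := by
  simp only [SupportedOn, not_forall] at hS
  obtain ⟨a, b, h0, h1⟩ := hS
  by_contra h
  refine h1 ?_
  have : IsEmpty {i : Fin n // (x i, y i) = (a, b)} := by
    refine ⟨fun ⟨i, hi⟩ => h (Finset.prod_eq_zero (Finset.mem_univ i) ?_)⟩
    obtain ⟨rfl, rfl⟩ := Prod.mk.inj hi
    exact h0
  rw [jointEmp, empDist, Nat.card_of_isEmpty, Nat.cast_zero, zero_div]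

end Types

/-! ### Exponents -/

/-- The logarithmic scale of polynomial factors in the block length. -/
noncomputable def logSlack (n : ℕ) : ℝ := 1 + Real.log (n + 1)

theorem one_le_logSlack (n : ℕ) : 1 ≤ logSlack n := by
  have : 0 ≤ Real.log ((n : ℝ) + 1) := Real.log_nonneg (by linarith [n.cast_nonneg (α := ℝ)])
  unfold logSlack; linarith

theorem tendsto_logSlack_div : Tendsto (fun n : ℕ => logSlack n / n) atTop (nhds 0) := by
  have h1 : Tendsto (fun x : ℝ => Real.log x / x) atTop (nhds 0) := by
    simpa using Real.isLittleO_log_id_atTop.tendsto_div_nhds_zero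
  have h2 : Tendsto (fun n : ℕ => Real.log ((n : ℝ) + 1) / ((n : ℝ) + 1)) atTop (nhds 0) :=
    h1.comp (tendsto_atTop_add_const_right _ _ tendsto_natCast_atTop_atTop)
  have h3 : Tendsto (fun n : ℕ => 1 / (n : ℝ)) atTop (nhds 0) := tendsto_one_div_atTop_nhds_zero_nat
  have h4 := h3.add (h2.mul (h3.const_add 1))
  simp only [zero_mul, add_zero] at h4
  refine h4.congr' ?_
  filter_upwards [eventually_ne_atTop 0] with n hn
  have : (n : ℝ) ≠ 0 := by exact_mod_cast hn
  have : (n : ℝ) + 1 ≠ 0 := by positivity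
  unfold logSlack
  field_simp

theorem tendsto_add_mul_logSlack_div (v K : ℝ) :
    Tendsto (fun n : ℕ => ((v + K * (logSlack n / n) : ℝ) : EReal)) atTop (nhds (v : EReal)) := by
  have h : Tendsto (fun n : ℕ => v + K * (logSlack n / n)) atTop (nhds v) := by
    simpa using (tendsto_logSlack_div.const_mul K).const_add v
  exact (continuous_coe_real_ereal.tendsto v).comp h

theorem coe_le_neg_log_div {n : ℕ} (hn : n ≠ 0) {a c : ℝ} (h : a ≤ Real.exp (-(n * c))) :
    (c : EReal) ≤ (-ENNReal.log (ENNReal.ofReal a)) / ((n : ℝ) : EReal) := by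
  have hn' : (0 : ℝ) < n := by exact_mod_cast Nat.pos_of_ne_zero hn
  have h1 : ENNReal.log (ENNReal.ofReal a) ≤ ((-(n * c) : ℝ) : EReal) := by
    rw [← Real.log_exp (-(n * c)), ← log_ofReal_of_pos (Real.exp_pos _)]
    exact ENNReal.log_monotone (ENNReal.ofReal_le_ofReal h)
  rw [EReal.le_div_iff_mul_le (by exact_mod_cast hn') (EReal.coe_ne_top _)]
  rw [← EReal.neg_le_neg_iff, neg_neg]
  refine h1.trans_eq ?_
  rw [← EReal.coe_mul, ← EReal.coe_neg, mul_comm]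

theorem neg_log_div_le_coe {n : ℕ} (hn : n ≠ 0) {a c : ℝ} (h : Real.exp (-(n * c)) ≤ a) :
    (-ENNReal.log (ENNReal.ofReal a)) / ((n : ℝ) : EReal) ≤ (c : EReal) := by
  have hn' : (0 : ℝ) < n := by exact_mod_cast Nat.pos_of_ne_zero hn
  have h1 : ((-(n * c) : ℝ) : EReal) ≤ ENNReal.log (ENNReal.ofReal a) := by
    rw [← Real.log_exp (-(n * c)), ← log_ofReal_of_pos (Real.exp_pos _)]
    exact ENNReal.log_monotone (ENNReal.ofReal_le_ofReal h)
  rw [EReal.div_le_iff_le_mul (by exact_mod_cast hn') (EReal.coe_ne_top _)]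
  rw [← EReal.neg_le_neg_iff, neg_neg]
  refine Eq.trans_le ?_ h1
  rw [← EReal.coe_mul, ← EReal.coe_neg]

/-- A polynomial factor `exp (K * logSlack n)` is free, as `logSlack n / n` tends to zero. -/
theorem le_exponent {X : Type*} [Fintype X] {P : X → ℝ} {a : ℕ → ℝ} {v : ℝ} (K : ℝ)
    (h : ∀ n : ℕ, n ≠ 0 → (typeClass P n).Nonempty → a n ≤ Real.exp (K * logSlack n - n * v)) :
    (v : EReal) ≤ exponent P a := by
  refine le_of_forall_lt_imp_le_of_dense fun c hc => ?_
  have ht := (tendsto_add_mul_logSlack_div v (-K)).eventually_const_lt hc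
  refine le_liminf_of_le (by isBoundedDefault) ?_
  rw [eventually_inf_principal]
  filter_upwards [ht, eventually_ne_atTop 0] with n h1 hn hT
  refine h1.le.trans (coe_le_neg_log_div hn ((h n hn hT).trans_eq ?_))
  have : (n : ℝ) ≠ 0 := by exact_mod_cast hn
  congr 1
  field_simp
  ring

/-- Because the exponent is a liminf, a lower bound at infinitely many block lengths is enough. This
lets a rational joint type, available only at multiples of its denominator, bound the exponent. -/
theorem exponent_le {X : Type*} [Fintype X] {P : X → ℝ} {a : ℕ → ℝ} {v : ℝ} (K : ℝ)
    (h : ∃ᶠ n : ℕ in atTop, (typeClass P n).Nonempty ∧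
      Real.exp (-(K * logSlack n) - n * v) ≤ a n) :
    exponent P a ≤ (v : EReal) := by
  refine le_of_forall_gt_imp_ge_of_dense fun c hc => ?_
  have ht := (tendsto_add_mul_logSlack_div v K).eventually_lt_const hc
  refine liminf_le_of_frequently_le' ?_
  rw [frequently_inf_principal]
  refine (h.and_eventually (ht.and (eventually_ne_atTop 0))).mono ?_
  rintro n ⟨⟨hT, h1⟩, h2, hn⟩
  refine ⟨hT, (neg_log_div_le_coe hn (Eq.trans_le ?_ h1)).trans h2.le⟩
  have : (n : ℝ) ≠ 0 := by exact_mod_cast hn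
  congr 1
  field_simp
  ring

/-! ### Ensemble averages -/

section Ensemble

variable {X Y : Type*} [Fintype X] [Fintype Y] {P : X → ℝ} {n M : ℕ}

theorem ensembleAvg_const_mul (c : ℝ) (F : (Fin M → Fin n → X) → ℝ) :
    ensembleAvg P n M (fun C => c * F C) = c * ensembleAvg P n M F := by
  simp only [ensembleAvg, ← Finset.mul_sum, mul_div_assoc]

theorem ensembleAvg_sum {ι : Type*} (s : Finset ι) (F : ι → (Fin M → Fin n → X) → ℝ) :
    ensembleAvg P n M (fun C => ∑ i ∈ s, F i C) = ∑ i ∈ s, ensembleAvg P n M (F i) := by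
  simp only [ensembleAvg, Finset.sum_div]
  exact Finset.sum_comm

/-- Independence of the codewords: a sum of products over a product set factorizes. Averages over
one or two codewords follow by setting the other factors to `1`. -/
theorem ensembleAvg_prod (h : Fin M → (Fin n → X) → ℝ) :
    ensembleAvg P n M (fun C => ∏ i, h i (C i)) =
      ∏ i, (∑ x ∈ typeClass P n, h i x) / (typeClass P n).card := by
  classical
  simp only [Finset.sum_div]
  rw [ensembleAvg, Fintype.card_piFinset, Finset.prod_univ_sum, Finset.sum_div]
  refine Finset.sum_congr rfl fun C _ => ?_
  rw [Finset.prod_div_distrib]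
  push_cast
  rfl

theorem ensembleAvg_apply (hT : (typeClass P n).Nonempty) (m : Fin M) (F : (Fin n → X) → ℝ) :
    ensembleAvg P n M (fun C => F (C m)) =
      (∑ x ∈ typeClass P n, F x) / (typeClass P n).card := by
  classical
  have ht : ((typeClass P n).card : ℝ) ≠ 0 := by exact_mod_cast hT.card_pos.ne'
  have := ensembleAvg_prod (P := P) (n := n) (M := M) (fun i x => if i = m then F x else 1)
  rw [Fintype.prod_eq_single m (fun i hi => by simp [hi, ht])] at this
  simp only [if_true] at this
  rw [← this]
  congr 1
  ext C
  rw [Fintype.prod_eq_single m (fun i hi => by simp [hi])]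
  simp

theorem ensembleAvg_mul_apply (hT : (typeClass P n).Nonempty) {m l : Fin M} (hml : m ≠ l)
    (F G : (Fin n → X) → ℝ) :
    ensembleAvg P n M (fun C => F (C m) * G (C l)) =
      (∑ x ∈ typeClass P n, F x) / (typeClass P n).card *
        ((∑ x ∈ typeClass P n, G x) / (typeClass P n).card) := by
  classical
  have ht : ((typeClass P n).card : ℝ) ≠ 0 := by exact_mod_cast hT.card_pos.ne'
  have := ensembleAvg_prod (P := P) (n := n) (M := M)
    (fun i x => if i = m then F x else if i = l then G x else 1)
  rw [Fintype.prod_eq_mul m l hml (fun i hi => by simp [hi.1, hi.2, ht])] at this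
  simp only [if_true, hml.symm, if_false] at this
  rw [← this]
  congr 1
  ext C
  rw [Fintype.prod_eq_mul m l hml (fun i hi => by simp [hi.1, hi.2])]
  simp [hml.symm]

open Classical in
/-- The probability that message `m` is not on the list, given that `x` is sent. -/
noncomputable def missProb (W : X → Y → ℝ) (g : (Y → ℝ) → EReal) (x : Fin n → X) : ℝ :=
  ∑ y, if g (empDist y) ≤ logLik W (jointEmp x y) then 0 else channelProb W x y

open Classical in
/-- The fraction of `x` in the type class that meet the threshold at output `y`. -/
noncomputable def passFraction (W : X → Y → ℝ) (P : X → ℝ) (g : (Y → ℝ) → EReal)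
    (y : Fin n → Y) : ℝ :=
  (∑ x ∈ typeClass P n, if g (empDist y) ≤ logLik W (jointEmp x y) then (1 : ℝ) else 0) /
    (typeClass P n).card

/-- The output distribution of the uniform distribution on the type class. -/
noncomputable def outputProb (W : X → Y → ℝ) (P : X → ℝ) (y : Fin n → Y) : ℝ :=
  (∑ x ∈ typeClass P n, channelProb W x y) / (typeClass P n).card

theorem ensembleAvg_errorProb (hT : (typeClass P n).Nonempty) (hM : M ≠ 0) (W : X → Y → ℝ)
    (g : (Y → ℝ) → EReal) :
    ensembleAvg P n M (fun C => errorProb W C (outputDecoder W g n M C)) =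
      (∑ x ∈ typeClass P n, missProb W g x) / (typeClass P n).card := by
  classical
  have hM' : (M : ℝ) ≠ 0 := by exact_mod_cast hM
  have h1 : ∀ C : Fin M → Fin n → X, errorProb W C (outputDecoder W g n M C) =
      (1 / (M : ℝ)) * ∑ m, missProb W g (C m) := by
    intro C
    refine congrArg _ (Finset.sum_congr rfl fun m _ => Finset.sum_congr rfl fun y _ => ?_)
    exact if_congr Iff.rfl rfl rfl
  simp only [h1]
  rw [ensembleAvg_const_mul, ensembleAvg_sum, Finset.sum_congr rfl fun m _ =>
    ensembleAvg_apply hT m (missProb W g)]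
  simp only [Finset.sum_const, Finset.card_univ, Fintype.card_fin, nsmul_eq_mul]
  field_simp

/-- Distinct codewords are independent, so all `M * (M - 1)` ordered pairs contribute equally, and
`1 / M` cancels one factor. -/
theorem ensembleAvg_listSize (hT : (typeClass P n).Nonempty) (hM : M ≠ 0) (W : X → Y → ℝ)
    (g : (Y → ℝ) → EReal) :
    ensembleAvg P n M (fun C => listSize W C (outputDecoder W g n M C)) =
      (M - 1) * ∑ y : Fin n → Y, outputProb W P y * passFraction W P g y := by
  classical
  have hM' : (M : ℝ) ≠ 0 := by exact_mod_cast hM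
  have h1 : ∀ C : Fin M → Fin n → X, listSize W C (outputDecoder W g n M C) =
      ∑ y : Fin n → Y, (1 / (M : ℝ)) * ∑ m, ∑ l, (if l ≠ m then (1 : ℝ) else 0) *
        (channelProb W (C m) y * if g (empDist y) ≤ logLik W (jointEmp (C l) y) then 1 else 0) := by
    intro C
    refine Finset.sum_congr rfl fun y _ => ?_
    congr 1
    refine Finset.sum_congr rfl fun m _ => ?_
    rw [Finset.mul_sum]
    refine Finset.sum_congr rfl fun l _ => ?_
    simp only [outputDecoder, Set.mem_ofPred_eq]
    by_cases hl : l = m <;> simp [hl]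
  have h2 : ∀ (y : Fin n → Y) (m l : Fin M), ensembleAvg P n M (fun C =>
      (if l ≠ m then (1 : ℝ) else 0) * (channelProb W (C m) y *
        if g (empDist y) ≤ logLik W (jointEmp (C l) y) then 1 else 0)) =
      (if l ≠ m then (1 : ℝ) else 0) * (outputProb W P y * passFraction W P g y) := by
    intro y m l
    rw [ensembleAvg_const_mul]
    by_cases hl : l = m
    · simp [hl]
    · congr 1
      exact ensembleAvg_mul_apply hT (Ne.symm hl) (fun x => channelProb W x y)
        (fun x => if g (empDist y) ≤ logLik W (jointEmp x y) then 1 else 0)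
  have h3 : ∑ m : Fin M, ∑ l : Fin M, (if l ≠ m then (1 : ℝ) else 0) = M * (M - 1) := by
    have : ∀ m : Fin M, ∑ l : Fin M, (if l ≠ m then (1 : ℝ) else 0) = M - 1 := by
      intro m
      have h : ∀ l : Fin M, (if l ≠ m then (1 : ℝ) else 0) = 1 - if l = m then 1 else 0 := by
        intro l; by_cases h : l = m <;> simp [h]
      simp [h, Finset.sum_sub_distrib]
    simp only [this]
    simp
    ring
  simp only [h1, ensembleAvg_sum, ensembleAvg_const_mul, h2, ← Finset.sum_mul, h3]
  rw [Finset.mul_sum]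
  refine Finset.sum_congr rfl fun y _ => ?_
  field_simp

end Ensemble

/-! ### Exponential bounds on the average miss probability and list size. -/

section Bounds

variable {A X Y : Type*} [Fintype A] [Fintype X] [Fintype Y] {n : ℕ}

theorem card_typeClass_le (hn : n ≠ 0) (v : Fin n → A) :
    ((typeClass (empDist v) n).card : ℝ) ≤
      Real.exp (n * entropy (empDist v) + (Fintype.card A + 1) * logSlack n) := by
  have h := (abs_le.1 (abs_log_card_typeClass_sub_le hn v)).2
  have hpos : (0 : ℝ) < (typeClass (empDist v) n).card := by
    exact_mod_cast Finset.card_pos.2 ⟨v, mem_typeClass.2 rfl⟩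
  rw [← Real.log_le_iff_le_exp hpos]
  unfold logSlack
  linarith

theorem le_card_typeClass (hn : n ≠ 0) (v : Fin n → A) :
    Real.exp (n * entropy (empDist v) - (Fintype.card A + 1) * logSlack n) ≤
      ((typeClass (empDist v) n).card : ℝ) := by
  have h := (abs_le.1 (abs_log_card_typeClass_sub_le hn v)).1
  have hpos : (0 : ℝ) < (typeClass (empDist v) n).card := by
    exact_mod_cast Finset.card_pos.2 ⟨v, mem_typeClass.2 rfl⟩
  rw [← Real.le_log_iff_exp_le hpos]
  unfold logSlack
  linarith

open Classical in
/-- The set of all types at block length `n`. -/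
noncomputable def types (A : Type*) [Fintype A] (n : ℕ) : Finset (A → ℝ) :=
  (Finset.univ : Finset (Fin n → A)).image empDist

theorem empDist_mem_types (v : Fin n → A) : empDist v ∈ types A n := by
  classical
  exact Finset.mem_image_of_mem _ (Finset.mem_univ _)

theorem card_types_le : ((types A n).card : ℝ) ≤ Real.exp (Fintype.card A * logSlack n) := by
  classical
  have h : ((types A n).card : ℝ) ≤ ((n : ℝ) + 1) ^ Fintype.card A := by
    exact_mod_cast (card_image_empDist_le (A := A) (n := n))
  refine h.trans ?_
  rw [Real.exp_nat_mul]
  refine pow_le_pow_left₀ (by positivity) ?_ _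
  calc (n : ℝ) + 1 = Real.exp (Real.log (n + 1)) := (Real.exp_log (by positivity)).symm
    _ ≤ _ := Real.exp_le_exp.2 (by unfold logSlack; linarith)

theorem jointEmp_mem_jointDists (hn : n ≠ 0) {P : X → ℝ} {x : Fin n → X}
    (hx : x ∈ typeClass P n) (y : Fin n → Y) : jointEmp x y ∈ jointDists Y P :=
  ⟨empDist_mem_stdSimplex hn _, by rw [margX_jointEmp, mem_typeClass.1 hx]⟩

open Classical in
theorem sum_sum_eq_sum_types (s : Finset (Fin n → X)) (h : (Fin n → X) → (Fin n → Y) → ℝ)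
    (y : Fin n → Y) :
    ∑ x ∈ s, h x y = ∑ Q ∈ types (X × Y) n, ∑ x ∈ s, if jointEmp x y = Q then h x y else 0 := by
  rw [Finset.sum_comm]
  refine Finset.sum_congr rfl fun x _ => ?_
  rw [Finset.sum_ite_eq, if_pos]
  exact empDist_mem_types _

open Classical in
theorem sum_ite_jointEmp_le {s : Finset (Fin n → X)} {Q : X × Y → ℝ} {y : Fin n → Y}
    {h : (Fin n → X) → ℝ} {c : ℝ} (hc : 0 ≤ c) (hh : ∀ x ∈ s, jointEmp x y = Q → h x ≤ c) :
    (∑ x ∈ s, if jointEmp x y = Q then h x else 0) ≤ jointCount Q y * c := by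
  calc (∑ x ∈ s, if jointEmp x y = Q then h x else 0)
      ≤ ∑ x ∈ s, if jointEmp x y = Q then c else 0 := Finset.sum_le_sum fun x hx => by
        split_ifs with hQ
        exacts [hh x hx hQ, le_rfl]
    _ ≤ ∑ x, if jointEmp x y = Q then c else 0 :=
        Finset.sum_le_sum_of_subset_of_nonneg (Finset.subset_univ _) fun x _ _ => by
          split_ifs
          exacts [hc, le_rfl]
    _ = jointCount Q y * c := by
        rw [← Finset.sum_filter, Finset.sum_const, nsmul_eq_mul, jointCount]

/-- The average miss probability decays with exponent `E` if all missed joint types have divergence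
at least `E`. -/
theorem sum_missProb_le {W : X → Y → ℝ} (hW : ∀ x y, 0 ≤ W x y) {P : X → ℝ} (hn : n ≠ 0)
    (hT : (typeClass P n).Nonempty) {g : (Y → ℝ) → EReal} {E : ℝ}
    (hg : ∀ Q ∈ jointDists Y P, SupportedOn W Q → ¬ g (margY Q) ≤ logLik W Q →
      E ≤ realCondDiv W P Q) :
    (∑ x ∈ typeClass P n, missProb W g x) / (typeClass P n).card ≤
      Real.exp ((2 * Fintype.card (X × Y) + Fintype.card X + 2) * logSlack n - n * E) := by
  classical
  obtain ⟨x₀, hx₀⟩ := hT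
  have ht : (0 : ℝ) < (typeClass P n).card := by exact_mod_cast Finset.card_pos.2 ⟨x₀, hx₀⟩
  have htlow : Real.exp (n * entropy P - (Fintype.card X + 1) * logSlack n) ≤
      (typeClass P n).card := by
    have := le_card_typeClass hn x₀
    rwa [mem_typeClass.1 hx₀] at this
  set h : (Fin n → X) → (Fin n → Y) → ℝ := fun x y =>
    if g (empDist y) ≤ logLik W (jointEmp x y) then 0 else channelProb W x y with hh
  have hsum : ∑ x ∈ typeClass P n, missProb W g x =
      ∑ Q ∈ types (X × Y) n, ∑ y, ∑ x ∈ typeClass P n, if jointEmp x y = Q then h x y else 0 := by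
    rw [Finset.sum_comm (s := types (X × Y) n)]
    simp only [← sum_sum_eq_sum_types]
    rw [Finset.sum_comm]
    rfl
  -- A type contributes at most its class size times `exp (n f(Q))`, that is `exp (n (H(P) - D(Q)))`
  -- up to slack; normalizing by the type class of `P` removes `H(P)`.
  have hterm : ∀ Q ∈ types (X × Y) n,
      (∑ y, ∑ x ∈ typeClass P n, if jointEmp x y = Q then h x y else 0) ≤
        Real.exp (n * entropy P + (Fintype.card (X × Y) + 1) * logSlack n - n * E) := by
    intro Q hQ
    obtain ⟨z, -, rfl⟩ := Finset.mem_image.1 hQ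
    by_cases hbad : empDist z ∈ jointDists Y P ∧ SupportedOn W (empDist z) ∧
        ¬ g (margY (empDist z)) ≤ logLik W (empDist z)
    · have hE := hg _ hbad.1 hbad.2.1 hbad.2.2
      have h1 : ∀ y : Fin n → Y, (∑ x ∈ typeClass P n, if jointEmp x y = empDist z
          then h x y else 0) ≤
            jointCount (empDist z) y * Real.exp (n * realLogLik W (empDist z)) := by
        intro y
        refine sum_ite_jointEmp_le (Real.exp_pos _).le fun x _ hxy => ?_
        rw [hh]
        dsimp only
        split_ifs
        · exact (Real.exp_pos _).le
        · rw [channelProb_eq_exp hn hW (by rw [hxy]; exact hbad.2.1), hxy]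
      refine (Finset.sum_le_sum fun y _ => h1 y).trans ?_
      rw [← Finset.sum_mul, ← Nat.cast_sum, sum_jointCount]
      refine (mul_le_mul_of_nonneg_right (card_typeClass_le hn z) (Real.exp_pos _).le).trans ?_
      rw [← Real.exp_add]
      refine Real.exp_le_exp.2 ?_
      have : (n : ℝ) * E ≤ n * realCondDiv W P (empDist z) :=
        mul_le_mul_of_nonneg_left hE (by positivity)
      rw [realCondDiv] at this
      linarith
    · refine le_of_eq_of_le (Finset.sum_eq_zero fun y _ => Finset.sum_eq_zero fun x hx => ?_)
        (Real.exp_pos _).le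
      split_ifs with hxy
      · rw [hh]
        dsimp only
        split_ifs with hgood
        · rfl
        · refine channelProb_eq_zero fun hS => hbad ?_
          rw [← hxy]
          exact ⟨jointEmp_mem_jointDists hn hx y, hS, by rwa [margY_jointEmp]⟩
      · rfl
  rw [div_le_iff₀ ht, hsum]
  refine (Finset.sum_le_card_nsmul _ _ _ hterm).trans ?_
  rw [nsmul_eq_mul]
  -- The slack collects `|X × Y|` from the number of types, `|X × Y| + 1` from the joint class and
  -- `|X| + 1` from the type class of `P`.
  calc _ ≤ Real.exp (Fintype.card (X × Y) * logSlack n) *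
        Real.exp (n * entropy P + (Fintype.card (X × Y) + 1) * logSlack n - n * E) :=
        mul_le_mul_of_nonneg_right card_types_le (Real.exp_pos _).le
    _ = Real.exp ((2 * Fintype.card (X × Y) + Fintype.card X + 2) * logSlack n - n * E) *
          Real.exp (n * entropy P - (Fintype.card X + 1) * logSlack n) := by
        rw [← Real.exp_add, ← Real.exp_add]
        congr 1
        ring
    _ ≤ _ := mul_le_mul_of_nonneg_left htlow (Real.exp_pos _).le

/-- A missed joint type bounds the average miss probability from below. -/
theorem le_sum_missProb {W : X → Y → ℝ} (hW : ∀ x y, 0 ≤ W x y) {P : X → ℝ} (hn : n ≠ 0)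
    {g : (Y → ℝ) → EReal} {z : Fin n → X × Y} (hz : margX (empDist z) = P)
    (hS : SupportedOn W (empDist z)) (hbad : ¬ g (margY (empDist z)) ≤ logLik W (empDist z)) :
    Real.exp (-((Fintype.card (X × Y) + Fintype.card X + 2) * logSlack n)
      - n * realCondDiv W P (empDist z)) ≤
      (∑ x ∈ typeClass P n, missProb W g x) / (typeClass P n).card := by
  classical
  have hx₀ : (fun i => (z i).1) ∈ typeClass P n := mem_typeClass.2 (by rw [← margX_empDist, hz])
  have ht : (0 : ℝ) < (typeClass P n).card := by exact_mod_cast Finset.card_pos.2 ⟨_, hx₀⟩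
  have htup : ((typeClass P n).card : ℝ) ≤
      Real.exp (n * entropy P + (Fintype.card X + 1) * logSlack n) := by
    have := card_typeClass_le hn (fun i => (z i).1)
    rwa [mem_typeClass.1 hx₀] at this
  -- Only the pairs of joint type `empDist z` are kept; all of them are missed and have the same
  -- channel probability.
  have hmain : ((typeClass (empDist z) n).card : ℝ) * Real.exp (n * realLogLik W (empDist z)) ≤
      ∑ x ∈ typeClass P n, missProb W g x := by
    rw [← sum_jointCount, Nat.cast_sum, Finset.sum_mul]
    unfold missProb
    rw [Finset.sum_comm]
    refine Finset.sum_le_sum fun y _ => ?_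
    rw [jointCount, ← nsmul_eq_mul, ← Finset.sum_const]
    refine (Finset.sum_le_sum fun x hx => ?_).trans
      (Finset.sum_le_sum_of_subset_of_nonneg (s := Finset.univ.filter fun x : Fin n → X =>
        jointEmp x y = empDist z) (fun x hx => ?_) fun x _ _ => ?_)
    · have hxy := (Finset.mem_filter.1 hx).2
      rw [if_neg (by rw [hxy, ← margY_jointEmp x y, hxy]; exact hbad),
        channelProb_eq_exp hn hW (by rw [hxy]; exact hS), hxy]
    · have hxy := (Finset.mem_filter.1 hx).2
      rw [mem_typeClass, ← margX_jointEmp x y, hxy, hz]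
    · split_ifs
      exacts [le_rfl, channelProb_nonneg hW x y]
  rw [le_div_iff₀ ht]
  refine le_trans ?_ hmain
  refine (mul_le_mul_of_nonneg_left htup (Real.exp_pos _).le).trans ?_
  refine le_trans ?_ (mul_le_mul_of_nonneg_right (le_card_typeClass hn z) (Real.exp_pos _).le)
  rw [← Real.exp_add, ← Real.exp_add]
  refine Real.exp_le_exp.2 (le_of_eq ?_)
  rw [realCondDiv]
  ring

/-- The mass of a pair of joint types in the average list size decays with the exponent of the
pair. -/
theorem sum_outputProb_mul_passFraction_le {W : X → Y → ℝ} (hW : ∀ x y, 0 ≤ W x y) {P : X → ℝ}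
    (hn : n ≠ 0) (hT : (typeClass P n).Nonempty) {g : (Y → ℝ) → EReal} {v : ℝ}
    (hg : ∀ Qt ∈ jointDists Y P, SupportedOn W Qt → ∀ Q ∈ listFeasible W P g Qt,
      v ≤ realCondDiv W P Qt + mutualInfo Q) :
    ∑ y : Fin n → Y, outputProb W P y * passFraction W P g y ≤
      Real.exp ((4 * Fintype.card (X × Y) + 2 * Fintype.card X + Fintype.card Y + 5) * logSlack n
        - n * v) := by
  classical
  obtain ⟨x₀, hx₀⟩ := hT
  set t : ℝ := ((typeClass P n).card : ℝ) with ht_def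
  have ht : 0 < t := by rw [ht_def]; exact_mod_cast Finset.card_pos.2 ⟨x₀, hx₀⟩
  have htlow : Real.exp (n * entropy P - (Fintype.card X + 1) * logSlack n) ≤ t := by
    have := le_card_typeClass hn x₀
    rwa [mem_typeClass.1 hx₀] at this
  set a : (X × Y → ℝ) → (Fin n → Y) → ℝ := fun Q y =>
    ∑ x ∈ typeClass P n, if jointEmp x y = Q then channelProb W x y else 0 with ha
  set b : (X × Y → ℝ) → (Fin n → Y) → ℝ := fun Q y =>
    ∑ x ∈ typeClass P n, if jointEmp x y = Q then
      (if g (empDist y) ≤ logLik W (jointEmp x y) then (1 : ℝ) else 0) else 0 with hb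
  have ha0 : ∀ Q y, 0 ≤ a Q y := fun Q y => Finset.sum_nonneg fun x _ => by
    split_ifs
    exacts [channelProb_nonneg hW x y, le_rfl]
  have hb0 : ∀ Q y, 0 ≤ b Q y := fun Q y => Finset.sum_nonneg fun x _ => by
    split_ifs <;> norm_num
  have hsum : ∑ y : Fin n → Y, outputProb W P y * passFraction W P g y =
      (∑ Qt ∈ types (X × Y) n, ∑ Q ∈ types (X × Y) n, ∑ y, a Qt y * b Q y) / t ^ 2 := by
    have h1 : ∀ y : Fin n → Y, outputProb W P y = (∑ Qt ∈ types (X × Y) n, a Qt y) / t :=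
      fun y => by rw [outputProb, sum_sum_eq_sum_types _ (fun x y => channelProb W x y) y]
    have h2 : ∀ y : Fin n → Y, passFraction W P g y = (∑ Q ∈ types (X × Y) n, b Q y) / t :=
      fun y => by
        rw [passFraction, sum_sum_eq_sum_types _ (fun x y =>
          if g (empDist y) ≤ logLik W (jointEmp x y) then (1 : ℝ) else 0) y]
    have h3 : ∑ Qt ∈ types (X × Y) n, ∑ Q ∈ types (X × Y) n, ∑ y, a Qt y * b Q y =
        ∑ y, (∑ Qt ∈ types (X × Y) n, a Qt y) * ∑ Q ∈ types (X × Y) n, b Q y := by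
      simp only [Finset.sum_mul_sum]
      rw [Finset.sum_comm (s := Finset.univ)]
      exact Finset.sum_congr rfl fun Qt _ => Finset.sum_comm
    rw [h3, Finset.sum_div]
    refine Finset.sum_congr rfl fun y _ => ?_
    rw [h1, h2]
    field_simp
  have hterm : ∀ Qt ∈ types (X × Y) n, ∀ Q ∈ types (X × Y) n, (∑ y, a Qt y * b Q y) ≤
      Real.exp (2 * (n * entropy P) + (2 * Fintype.card (X × Y) + Fintype.card Y + 3) * logSlack n
        - n * v) := by
    intro Qt hQt Q hQ
    -- A nonzero product exhibits an output `y₀` at which both types occur. It forces the equal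
    -- output marginals, the support condition and the threshold condition needed to apply `hg`.
    by_cases hzero : ∀ y, a Qt y * b Q y = 0
    · rw [Finset.sum_eq_zero fun y _ => hzero y]
      exact (Real.exp_pos _).le
    push Not at hzero
    obtain ⟨y₀, hy₀⟩ := hzero
    obtain ⟨x₁, hx₁, h₁⟩ := Finset.exists_ne_zero_of_sum_ne_zero (left_ne_zero_of_mul hy₀)
    obtain ⟨x₂, hx₂, h₂⟩ := Finset.exists_ne_zero_of_sum_ne_zero (right_ne_zero_of_mul hy₀)
    obtain ⟨hQ₁, hP₁⟩ : jointEmp x₁ y₀ = Qt ∧ channelProb W x₁ y₀ ≠ 0 := by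
      split_ifs at h₁ with h
      · exact ⟨h, h₁⟩
      · exact absurd rfl h₁
    obtain ⟨hQ₂, hg₂⟩ : jointEmp x₂ y₀ = Q ∧ g (empDist y₀) ≤ logLik W (jointEmp x₂ y₀) := by
      split_ifs at h₂ with h h'
      · exact ⟨h, h'⟩
      · exact absurd rfl h₂
      · exact absurd rfl h₂
    have hS : SupportedOn W Qt := by
      by_contra hS
      exact hP₁ (channelProb_eq_zero (by rwa [hQ₁]))
    have hQt' : Qt ∈ jointDists Y P := hQ₁ ▸ jointEmp_mem_jointDists hn hx₁ y₀
    have hQ' : Q ∈ jointDists Y P := hQ₂ ▸ jointEmp_mem_jointDists hn hx₂ y₀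
    have hmY : margY Q = empDist y₀ := by rw [← hQ₂, margY_jointEmp]
    have hmYt : margY Qt = empDist y₀ := by rw [← hQ₁, margY_jointEmp]
    have hv := hg Qt hQt' hS Q ⟨hQ', by rw [hmY, hmYt], by rw [hmY, ← hQ₂]; exact hg₂⟩
    rw [mutualInfo_eq hQ'.1.1, hQ'.2, hmY] at hv
    have htq : (0 : ℝ) < (typeClass (empDist y₀) n).card := by
      exact_mod_cast Finset.card_pos.2 ⟨y₀, mem_typeClass.2 rfl⟩
    -- By type class symmetry this bound is uniform in `y`, so the sum over `y` falls on `a` alone.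
    have hb1 : ∀ y, b Q y ≤ ((typeClass Q n).card : ℝ) / (typeClass (empDist y₀) n).card := by
      intro y
      have h := sum_ite_jointEmp_le (s := typeClass P n) (Q := Q) (y := y) (c := 1)
        (h := fun x => if g (empDist y) ≤ logLik W (jointEmp x y) then (1 : ℝ) else 0)
        zero_le_one (fun x _ _ => by split_ifs <;> norm_num)
      refine h.trans ?_
      rw [mul_one, le_div_iff₀ htq]
      by_cases hy : empDist y = margY Q
      · have := jointCount_mul_card_typeClass hy
        rw [hmY] at this
        exact_mod_cast this.le
      · have : jointCount Q y = 0 := by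
          rw [jointCount, Finset.card_eq_zero, Finset.filter_eq_empty_iff]
          rintro x - rfl
          exact hy (margY_jointEmp x y).symm
        rw [this]
        simp
    have ha1 : ∑ y, a Qt y ≤ (typeClass Qt n).card * Real.exp (n * realLogLik W Qt) := by
      rw [← sum_jointCount, Nat.cast_sum, Finset.sum_mul]
      refine Finset.sum_le_sum fun y _ => sum_ite_jointEmp_le (Real.exp_pos _).le fun x _ hxy => ?_
      rw [channelProb_eq_exp hn hW (by rw [hxy]; exact hS), hxy]
    have hcQ : ((typeClass Q n).card : ℝ) ≤
        Real.exp (n * entropy Q + (Fintype.card (X × Y) + 1) * logSlack n) := by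
      rw [← hQ₂]
      exact card_typeClass_le hn _
    have hcQt : ((typeClass Qt n).card : ℝ) ≤
        Real.exp (n * entropy Qt + (Fintype.card (X × Y) + 1) * logSlack n) := by
      rw [← hQ₁]
      exact card_typeClass_le hn _
    have hcq := le_card_typeClass hn y₀
    calc ∑ y, a Qt y * b Q y
        ≤ ∑ y, a Qt y * (((typeClass Q n).card : ℝ) / (typeClass (empDist y₀) n).card) :=
          Finset.sum_le_sum fun y _ => mul_le_mul_of_nonneg_left (hb1 y) (ha0 _ _)
      _ = (∑ y, a Qt y) * (((typeClass Q n).card : ℝ) / (typeClass (empDist y₀) n).card) := by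
          rw [Finset.sum_mul]
      _ ≤ (Real.exp (n * entropy Qt + (Fintype.card (X × Y) + 1) * logSlack n) *
            Real.exp (n * realLogLik W Qt)) *
          (Real.exp (n * entropy Q + (Fintype.card (X × Y) + 1) * logSlack n) /
            Real.exp (n * entropy (empDist y₀) - (Fintype.card Y + 1) * logSlack n)) := by
          refine mul_le_mul (ha1.trans ?_) ?_ (by positivity) (by positivity)
          · exact mul_le_mul_of_nonneg_right hcQt (Real.exp_pos _).le
          · exact div_le_div₀ (Real.exp_pos _).le hcQ (Real.exp_pos _) hcq
      _ ≤ _ := by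
          rw [← Real.exp_sub, ← Real.exp_add, ← Real.exp_add]
          refine Real.exp_le_exp.2 ?_
          have hv' := mul_le_mul_of_nonneg_left hv (Nat.cast_nonneg (α := ℝ) n)
          rw [realCondDiv] at hv'
          linarith
  rw [hsum, div_le_iff₀ (by positivity)]
  calc ∑ Qt ∈ types (X × Y) n, ∑ Q ∈ types (X × Y) n, ∑ y, a Qt y * b Q y
      ≤ (types (X × Y) n).card * ((types (X × Y) n).card * Real.exp (2 * (n * entropy P) +
          (2 * Fintype.card (X × Y) + Fintype.card Y + 3) * logSlack n - n * v)) := by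
        refine (Finset.sum_le_card_nsmul _ _ _ fun Qt hQt =>
          Finset.sum_le_card_nsmul _ _ _ fun Q hQ => hterm Qt hQt Q hQ).trans_eq ?_
        rw [nsmul_eq_mul, nsmul_eq_mul]
    _ ≤ Real.exp (Fintype.card (X × Y) * logSlack n) *
          (Real.exp (Fintype.card (X × Y) * logSlack n) * Real.exp (2 * (n * entropy P) +
          (2 * Fintype.card (X × Y) + Fintype.card Y + 3) * logSlack n - n * v)) := by
        have h := card_types_le (A := X × Y) (n := n)
        gcongr
    _ = Real.exp ((4 * Fintype.card (X × Y) + 2 * Fintype.card X + Fintype.card Y + 5) *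
          logSlack n - n * v) *
            Real.exp (n * entropy P - (Fintype.card X + 1) * logSlack n) ^ 2 := by
        rw [← Real.exp_nat_mul, ← Real.exp_add, ← Real.exp_add, ← Real.exp_add]
        congr 1
        push_cast
        ring
    _ ≤ _ := by gcongr

/-- A pair of joint types that share their output type bounds the average list size from below. -/
theorem le_sum_outputProb_mul_passFraction {W : X → Y → ℝ} (hW : ∀ x y, 0 ≤ W x y) {P : X → ℝ}
    (hn : n ≠ 0) {g : (Y → ℝ) → EReal} {zt z : Fin n → X × Y}
    (hzt : margX (empDist zt) = P) (hz : margX (empDist z) = P)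
    (hY : margY (empDist z) = margY (empDist zt))
    (hS : SupportedOn W (empDist zt)) (hg : g (margY (empDist z)) ≤ logLik W (empDist z)) :
    Real.exp (-((2 * Fintype.card (X × Y) + 2 * Fintype.card X + Fintype.card Y + 5) * logSlack n)
      - n * (realCondDiv W P (empDist zt) + mutualInfo (empDist z))) ≤
      ∑ y : Fin n → Y, outputProb W P y * passFraction W P g y := by
  classical
  have hx₀ : (fun i => (z i).1) ∈ typeClass P n := mem_typeClass.2 (by rw [← margX_empDist, hz])
  set t : ℝ := ((typeClass P n).card : ℝ) with ht_def
  have ht : 0 < t := by rw [ht_def]; exact_mod_cast Finset.card_pos.2 ⟨_, hx₀⟩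
  have htup : t ≤ Real.exp (n * entropy P + (Fintype.card X + 1) * logSlack n) := by
    have := card_typeClass_le hn (fun i => (z i).1)
    rwa [mem_typeClass.1 hx₀] at this
  set y₀ : Fin n → Y := fun i => (z i).2 with hy₀
  have hmY : margY (empDist z) = empDist y₀ := margY_empDist z
  have hmYt : margY (empDist zt) = empDist y₀ := by rw [← hY, hmY]
  have htq : (0 : ℝ) < (typeClass (empDist y₀) n).card := by
    exact_mod_cast Finset.card_pos.2 ⟨y₀, mem_typeClass.2 rfl⟩
  have hfil : ∀ {Q : X × Y → ℝ} (y : Fin n → Y), margX Q = P →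
      (Finset.univ.filter fun x : Fin n → X => jointEmp x y = Q) ⊆ typeClass P n := by
    intro Q y hQ x hx
    rw [mem_typeClass, ← margX_jointEmp x y, (Finset.mem_filter.1 hx).2, hQ]
  have hout : ∀ y ∈ typeClass (empDist y₀) n,
      ((typeClass (empDist zt) n).card : ℝ) / (typeClass (empDist y₀) n).card *
        Real.exp (n * realLogLik W (empDist zt)) / t ≤ outputProb W P y := by
    intro y hy
    have hc : jointCount (empDist zt) y * (typeClass (empDist y₀) n).card =
        (typeClass (empDist zt) n).card := by
      rw [← hmYt]
      exact jointCount_mul_card_typeClass (by rw [mem_typeClass.1 hy, hmYt])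
    rw [outputProb, ← ht_def]
    refine div_le_div_of_nonneg_right ?_ ht.le
    rw [← hc, Nat.cast_mul, mul_div_cancel_right₀ _ htq.ne', jointCount, ← nsmul_eq_mul,
      ← Finset.sum_const]
    refine (Finset.sum_le_sum fun x hx => ?_).trans
      (Finset.sum_le_sum_of_subset_of_nonneg (hfil y hzt)
        fun x _ _ => channelProb_nonneg hW x y)
    have hxy := (Finset.mem_filter.1 hx).2
    rw [channelProb_eq_exp hn hW (by rw [hxy]; exact hS), hxy]
  have hpass : ∀ y ∈ typeClass (empDist y₀) n,
      ((typeClass (empDist z) n).card : ℝ) / (typeClass (empDist y₀) n).card / t ≤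
        passFraction W P g y := by
    intro y hy
    have hc : jointCount (empDist z) y * (typeClass (empDist y₀) n).card =
        (typeClass (empDist z) n).card := by
      rw [← hmY]
      exact jointCount_mul_card_typeClass (by rw [mem_typeClass.1 hy, hmY])
    rw [passFraction, ← ht_def]
    refine div_le_div_of_nonneg_right ?_ ht.le
    rw [← hc, Nat.cast_mul, mul_div_cancel_right₀ _ htq.ne', jointCount, Finset.card_eq_sum_ones,
      Nat.cast_sum, Nat.cast_one]
    refine (Finset.sum_le_sum fun x hx => ?_).trans
      (Finset.sum_le_sum_of_subset_of_nonneg (hfil y hz) fun x _ _ => by split_ifs <;> norm_num)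
    have hxy := (Finset.mem_filter.1 hx).2
    rw [if_pos]
    rw [hxy, ← margY_jointEmp x y, hxy]
    exact hg
  have hnonneg : ∀ y : Fin n → Y, 0 ≤ outputProb W P y * passFraction W P g y := by
    intro y
    refine mul_nonneg (div_nonneg (Finset.sum_nonneg fun x _ => channelProb_nonneg hW x y)
      (Nat.cast_nonneg _)) (div_nonneg (Finset.sum_nonneg fun x _ => ?_) (Nat.cast_nonneg _))
    split_ifs <;> norm_num
  -- Only outputs of the common type are kept; there both factors have lower bounds independent of
  -- `y`.
  refine le_trans ?_ (Finset.sum_le_sum_of_subset_of_nonneg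
    (Finset.subset_univ (typeClass (empDist y₀) n)) fun y _ _ => hnonneg y)
  refine le_trans ?_ (Finset.sum_le_sum fun y hy =>
    mul_le_mul (hout y hy) (hpass y hy) (by positivity)
      ((by positivity : (0 : ℝ) ≤ _).trans (hout y hy)))
  rw [Finset.sum_const, nsmul_eq_mul]
  have h1 := le_card_typeClass hn zt
  have h2 := le_card_typeClass hn z
  have h3 := card_typeClass_le hn y₀
  have heq : ((typeClass (empDist y₀) n).card : ℝ) *
      (((typeClass (empDist zt) n).card : ℝ) / (typeClass (empDist y₀) n).card *
        Real.exp (n * realLogLik W (empDist zt)) / t *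
      (((typeClass (empDist z) n).card : ℝ) / (typeClass (empDist y₀) n).card / t)) =
      ((typeClass (empDist zt) n).card : ℝ) * Real.exp (n * realLogLik W (empDist zt)) *
        (typeClass (empDist z) n).card / ((typeClass (empDist y₀) n).card * t ^ 2) := by
    field_simp
  rw [heq]
  calc _ = Real.exp (n * entropy (empDist zt) - (Fintype.card (X × Y) + 1) * logSlack n) *
        Real.exp (n * realLogLik W (empDist zt)) *
        Real.exp (n * entropy (empDist z) - (Fintype.card (X × Y) + 1) * logSlack n) /
        (Real.exp (n * entropy (empDist y₀) + (Fintype.card Y + 1) * logSlack n) *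
          Real.exp (n * entropy P + (Fintype.card X + 1) * logSlack n) ^ 2) := by
        rw [← Real.exp_nat_mul, ← Real.exp_add, ← Real.exp_add, ← Real.exp_add, ← Real.exp_sub,
          mutualInfo_eq (empDist_nonneg z), hz, hmY, realCondDiv]
        congr 1
        push_cast
        ring
    _ ≤ _ := by gcongr

end Bounds

/-! ### From counting bounds to exponents, and the constraint at rational types. -/

section RandomCoding

variable {A X Y : Type*} [Fintype A] [Fintype X] [Fintype Y]

theorem numCodewords_ne_zero (R : ℝ) (n : ℕ) : numCodewords R n ≠ 0 :=
  (Nat.ceil_pos.2 (Real.exp_pos _)).ne'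

theorem numCodewords_sub_one_le (R : ℝ) (n : ℕ) :
    (numCodewords R n : ℝ) - 1 ≤ Real.exp (n * R) := by
  have := Nat.ceil_lt_add_one (Real.exp_pos (n * R)).le
  unfold numCodewords
  linarith

theorem numCodewords_sub_one_nonneg (R : ℝ) (n : ℕ) : 0 ≤ (numCodewords R n : ℝ) - 1 := by
  have : (1 : ℝ) ≤ numCodewords R n := by
    exact_mod_cast Nat.one_le_iff_ne_zero.2 (numCodewords_ne_zero R n)
  linarith

/-- A positive rate makes `exp (n R)` at least `2` eventually, so subtracting one codeword costs at
most a factor `2`, absorbed by `exp (logSlack n)`. -/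
theorem eventually_le_numCodewords_sub_one {R : ℝ} (hR : 0 < R) :
    ∀ᶠ n : ℕ in atTop, Real.exp (n * R - logSlack n) ≤ (numCodewords R n : ℝ) - 1 := by
  have h : Tendsto (fun n : ℕ => Real.exp (n * R)) atTop atTop :=
    Real.tendsto_exp_atTop.comp (tendsto_natCast_atTop_atTop.atTop_mul_const hR)
  filter_upwards [h.eventually_ge_atTop 2] with n hn
  have h1 : Real.exp (n * R) ≤ numCodewords R n := Nat.le_ceil _
  have h2 : Real.exp (n * R - logSlack n) ≤ Real.exp (n * R) / 2 := by
    rw [Real.exp_sub]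
    refine div_le_div_of_nonneg_left (Real.exp_pos _).le two_pos ?_
    have := Real.add_one_le_exp (logSlack n)
    linarith [one_le_logSlack n]
  linarith

theorem le_errorExponent {W : X → Y → ℝ} (hW : ∀ x y, 0 ≤ W x y) {P : X → ℝ} (R : ℝ)
    {g : (Y → ℝ) → EReal} {E : ℝ}
    (hg : ∀ Q ∈ jointDists Y P, SupportedOn W Q → ¬ g (margY Q) ≤ logLik W Q →
      E ≤ realCondDiv W P Q) :
    (E : EReal) ≤ errorExponent W P R (outputDecoder W g) := by
  refine le_exponent (2 * Fintype.card (X × Y) + Fintype.card X + 2) fun n hn hT => ?_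
  rw [ensembleAvg_errorProb hT (numCodewords_ne_zero R n)]
  exact sum_missProb_le hW hn hT hg

theorem le_listExponent {W : X → Y → ℝ} (hW : ∀ x y, 0 ≤ W x y) {P : X → ℝ} (R : ℝ)
    {g : (Y → ℝ) → EReal} {v : ℝ}
    (hg : ∀ Qt ∈ jointDists Y P, SupportedOn W Qt → ∀ Q ∈ listFeasible W P g Qt,
      v + R ≤ realCondDiv W P Qt + mutualInfo Q) :
    (v : EReal) ≤ listExponent W P R (outputDecoder W g) := by
  refine le_exponent (4 * Fintype.card (X × Y) + 2 * Fintype.card X + Fintype.card Y + 5)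
    fun n hn hT => ?_
  rw [ensembleAvg_listSize hT (numCodewords_ne_zero R n)]
  refine (mul_le_mul_of_nonneg_left (sum_outputProb_mul_passFraction_le hW hn hT hg)
    (numCodewords_sub_one_nonneg R n)).trans ?_
  refine (mul_le_mul_of_nonneg_right (numCodewords_sub_one_le R n) (Real.exp_pos _).le).trans ?_
  rw [← Real.exp_add]
  refine Real.exp_le_exp.2 (le_of_eq ?_)
  ring

/-- For `n` divisible by the product of the denominators, all `n * p a` are natural numbers and can
serve as letter counts. -/
theorem exists_dvd_imp_exists_empDist_eq {p : A → ℝ} (hp : p ∈ stdSimplex ℝ A)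
    (hrat : ∀ a, ∃ r : ℚ, p a = r) :
    ∃ N : ℕ, N ≠ 0 ∧ ∀ n : ℕ, n ≠ 0 → N ∣ n → ∃ z : Fin n → A, empDist z = p := by
  choose r hr using hrat
  refine ⟨∏ a, (r a).den, Finset.prod_ne_zero_iff.2 fun a _ => (r a).den_ne_zero,
    fun n hn hdvd => ?_⟩
  have hn' : (n : ℝ) ≠ 0 := by exact_mod_cast hn
  have hk : ∀ a, ∃ k : ℕ, (k : ℝ) = n * p a := by
    intro a
    obtain ⟨m, hm⟩ := (Finset.dvd_prod_of_mem (fun a => (r a).den) (Finset.mem_univ a)).trans hdvd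
    have h0 : 0 ≤ r a := by
      have := hp.1 a
      rw [hr] at this
      exact_mod_cast this
    obtain ⟨q, hq⟩ := Int.eq_ofNat_of_zero_le (Rat.num_nonneg.2 h0)
    refine ⟨m * q, ?_⟩
    have h1 : (r a) * (r a).den = (q : ℚ) := by
      rw [Rat.mul_den_eq_num, hq]
      simp
    have h2 : (n : ℚ) * r a = m * q := by
      rw [hm, ← h1]
      push_cast
      ring
    rw [hr]
    exact_mod_cast h2.symm
  choose k hk using hk
  have hsum : ∑ a, k a = n := by
    have : (∑ a, (k a : ℝ)) = n := by
      simp only [hk, ← Finset.mul_sum, hp.2, mul_one]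
    exact_mod_cast this
  obtain ⟨z, hz⟩ := exists_empDist_eq k hsum
  refine ⟨z, funext fun a => ?_⟩
  rw [hz, hk]
  field_simp

theorem frequently_dvd {N : ℕ} (hN : N ≠ 0) : ∃ᶠ n : ℕ in atTop, n ≠ 0 ∧ N ∣ n := by
  rw [frequently_atTop]
  refine fun a => ⟨N * (a + 1), ?_, by positivity, dvd_mul_right _ _⟩
  nlinarith [Nat.pos_of_ne_zero hN]

/-- A decoder with error exponent at least `E` does not miss rational joint types of divergence
less than `E`. -/
theorem threshold_le_of_le_errorExponent {W : X → Y → ℝ} (hW : ∀ x y, 0 ≤ W x y) {P : X → ℝ}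
    {R E : ℝ} {g : (Y → ℝ) → EReal} (hE : (E : EReal) ≤ errorExponent W P R (outputDecoder W g))
    {Q : X × Y → ℝ} (hQ : Q ∈ jointDists Y P) (hS : SupportedOn W Q)
    (hrat : ∀ z, ∃ r : ℚ, Q z = r) (hlt : realCondDiv W P Q < E) :
    g (margY Q) ≤ logLik W Q := by
  by_contra hbad
  obtain ⟨N, hN, hz⟩ := exists_dvd_imp_exists_empDist_eq hQ.1 hrat
  refine absurd hlt (not_lt.2 (EReal.coe_le_coe_iff.1 (hE.trans
    (exponent_le (Fintype.card (X × Y) + Fintype.card X + 2) ?_))))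
  -- At every nonzero multiple of `N`, `Q` is itself a type, so missing it costs about `exp (-n
  -- D(Q))`.
  refine (frequently_dvd hN).mono fun n hn => ?_
  obtain ⟨z, rfl⟩ := hz n hn.1 hn.2
  have hT : (typeClass P n).Nonempty :=
    ⟨fun i => (z i).1, mem_typeClass.2 (by rw [← margX_empDist, hQ.2])⟩
  refine ⟨hT, ?_⟩
  rw [ensembleAvg_errorProb hT (numCodewords_ne_zero R n)]
  exact le_sum_missProb hW hn.1 hQ.2 hS hbad

theorem listExponent_le {W : X → Y → ℝ} (hW : ∀ x y, 0 ≤ W x y) {P : X → ℝ}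
    {R : ℝ} (hR : 0 < R) {g : (Y → ℝ) → EReal} {Qt Q : X × Y → ℝ}
    (hQt : Qt ∈ jointDists Y P) (hQ : Q ∈ jointDists Y P) (hY : margY Q = margY Qt)
    (hS : SupportedOn W Qt) (hratt : ∀ z, ∃ r : ℚ, Qt z = r) (hrat : ∀ z, ∃ r : ℚ, Q z = r)
    (hg : g (margY Q) ≤ logLik W Q) :
    listExponent W P R (outputDecoder W g) ≤
      ((realCondDiv W P Qt + mutualInfo Q - R : ℝ) : EReal) := by
  obtain ⟨N, hN, hz⟩ := exists_dvd_imp_exists_empDist_eq hQ.1 hrat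
  obtain ⟨N', hN', hzt⟩ := exists_dvd_imp_exists_empDist_eq hQt.1 hratt
  -- The constant is that of the list size bound plus one, for the number of codewords.
  refine exponent_le (2 * Fintype.card (X × Y) + 2 * Fintype.card X + Fintype.card Y + 6) ?_
  refine ((frequently_dvd (mul_ne_zero hN hN')).and_eventually
    (eventually_le_numCodewords_sub_one hR)).mono fun n hn => ?_
  obtain ⟨⟨hn0, hdvd⟩, hM⟩ := hn
  obtain ⟨z, rfl⟩ := hz n hn0 ((dvd_mul_right _ _).trans hdvd)
  obtain ⟨zt, rfl⟩ := hzt n hn0 ((dvd_mul_left _ _).trans hdvd)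
  have hT : (typeClass P n).Nonempty :=
    ⟨fun i => (z i).1, mem_typeClass.2 (by rw [← margX_empDist, hQ.2])⟩
  refine ⟨hT, ?_⟩
  rw [ensembleAvg_listSize hT (numCodewords_ne_zero R n)]
  refine le_trans (le_of_eq ?_) (mul_le_mul hM
    (le_sum_outputProb_mul_passFraction hW hn0 hQt.2 hQ.2 hY hS hg) (Real.exp_pos _).le
    (numCodewords_sub_one_nonneg R n))
  rw [← Real.exp_add]
  congr 1
  ring

end RandomCoding

/-! ### Rational approximation -/

/-- Finitely many reals can be approximated by rationals in a way that respects all rational linear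
relations between them. -/
theorem exists_linearMap_rat_near {ι : Type*} [Finite ι] (u : ι → ℝ) {ε : ℝ} (hε : 0 < ε) :
    ∃ φ : ℝ →ₗ[ℚ] ℚ, φ 1 = 1 ∧ ∀ i, |(φ (u i) : ℝ) - u i| < ε := by
  classical
  -- A Hamel basis of `ℝ` over `ℚ` containing `1`: replacing its elements by nearby rationals, with
  -- `1` kept, defines `φ`.
  obtain ⟨κ, b, one, hb1⟩ : ∃ (κ : Type) (b : Module.Basis κ ℚ ℝ) (one : κ), b one = 1 := by
    have hli : LinearIndepOn ℚ id ({1} : Set ℝ) := LinearIndepOn.singleton one_ne_zero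
    exact ⟨_, Module.Basis.extend hli,
      ⟨1, hli.subset_extend (Set.subset_univ _) (Set.mem_singleton _)⟩,
      Module.Basis.extend_apply_self hli _⟩
  -- `C` bounds the coefficient sums of the finitely many `u i`, so moving each basis vector by less
  -- than `δ` moves `u i` by at most `C * δ`.
  obtain ⟨C, hC⟩ : ∃ C : ℝ, ∀ i, ∑ j ∈ (b.repr (u i)).support, |((b.repr (u i) j : ℚ) : ℝ)| ≤ C := by
    obtain ⟨C, hC⟩ := (Set.finite_range
      fun i => ∑ j ∈ (b.repr (u i)).support, |((b.repr (u i) j : ℚ) : ℝ)|).bddAbove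
    exact ⟨C, fun i => hC ⟨i, rfl⟩⟩
  set δ : ℝ := ε / (|C| + 1) with hδ_def
  have hδ : 0 < δ := by positivity
  have happ : ∀ j : κ, ∃ r : ℚ, |(r : ℝ) - b j| < δ ∧
      (j = one → r = 1) := by
    intro j
    by_cases hj : j = one
    · exact ⟨1, by simp [hj, hb1, hδ], fun _ => rfl⟩
    · obtain ⟨r, hr⟩ := exists_rat_near (b j) hδ
      exact ⟨r, by rwa [abs_sub_comm], fun h => absurd h hj⟩
  choose r hr hr1 using happ
  refine ⟨b.constr ℚ r, ?_, fun i => ?_⟩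
  · rw [← hb1, Module.Basis.constr_basis, hr1 one rfl]
  · have e1 : ((b.constr ℚ r (u i) : ℚ) : ℝ) =
        ∑ j ∈ (b.repr (u i)).support, ((b.repr (u i) j : ℚ) : ℝ) * (r j : ℝ) := by
      rw [Module.Basis.constr_apply, Finsupp.sum]
      push_cast
      simp [smul_eq_mul]
    have e2 : u i = ∑ j ∈ (b.repr (u i)).support, ((b.repr (u i) j : ℚ) : ℝ) * b j := by
      conv_lhs => rw [← b.linearCombination_repr (u i)]
      rw [Finsupp.linearCombination_apply, Finsupp.sum]
      simp [Rat.smul_def]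
    have e3 : (b.constr ℚ r (u i) : ℝ) - u i =
        ∑ j ∈ (b.repr (u i)).support, ((b.repr (u i) j : ℚ) : ℝ) * ((r j : ℝ) - b j) := by
      simp only [mul_sub, Finset.sum_sub_distrib]
      rw [e1, ← e2]
    rw [e3]
    calc _ ≤ ∑ j ∈ (b.repr (u i)).support, |((b.repr (u i) j : ℚ) : ℝ) * ((r j : ℝ) - b j)| :=
          Finset.abs_sum_le_sum_abs _ _
      _ ≤ ∑ j ∈ (b.repr (u i)).support, |((b.repr (u i) j : ℚ) : ℝ)| * δ :=
          Finset.sum_le_sum fun j _ => by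
            rw [abs_mul]
            exact mul_le_mul_of_nonneg_left (hr j).le (abs_nonneg _)
      _ ≤ C * δ := by
          rw [← Finset.sum_mul]
          exact mul_le_mul_of_nonneg_right (hC i) hδ.le
      _ ≤ |C| * δ := mul_le_mul_of_nonneg_right (le_abs_self C) hδ.le
      _ < (|C| + 1) * δ := by nlinarith
      _ = ε := by rw [hδ_def]; field_simp

/-- Zeros stay zero by linearity, and positive values keep their sign once the error is below each
of them. -/
theorem exists_linearMap_rat_near_nonneg {ι : Type*} [Finite ι] (u : ι → ℝ) {ε : ℝ} (hε : 0 < ε) :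
    ∃ φ : ℝ →ₗ[ℚ] ℚ, φ 1 = 1 ∧ (∀ i, |(φ (u i) : ℝ) - u i| < ε) ∧ ∀ i, 0 ≤ u i → 0 ≤ φ (u i) := by
  have h : ∀ᶠ δ : ℝ in nhdsWithin 0 (Set.Ioi 0), (∀ i, 0 < u i → δ < u i) ∧ δ < ε := by
    refine (eventually_all.2 fun i => ?_).and
      (nhdsWithin_le_nhds (Iio_mem_nhds hε))
    by_cases hi : 0 < u i
    · filter_upwards [nhdsWithin_le_nhds (Iio_mem_nhds hi)] with δ hδ _ using hδ
    · exact Eventually.of_forall fun _ h => absurd h hi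
  obtain ⟨δ, ⟨h1, h2⟩, hδ⟩ := (h.and self_mem_nhdsWithin).exists
  obtain ⟨φ, hφ1, hφ⟩ := exists_linearMap_rat_near u hδ
  refine ⟨φ, hφ1, fun i => (hφ i).trans h2, fun i hi => ?_⟩
  rcases hi.eq_or_lt with h0 | h0
  · rw [← h0, map_zero]
  · have h3 := (abs_lt.1 (hφ i)).1
    have h4 := h1 i h0
    have : (0 : ℝ) ≤ φ (u i) := by linarith
    exact_mod_cast this

section Approximation

variable {X Y : Type*} [Fintype X] [Fintype Y]

/-- The joint distributions with `X`-marginal `P` supported where `W` is positive. -/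
def supportedDists (W : X → Y → ℝ) (P : X → ℝ) : Set (X × Y → ℝ) :=
  {Q | Q ∈ jointDists Y P ∧ SupportedOn W Q}

theorem mem_jointDists_of_nonneg {P : X → ℝ} (hP : P ∈ stdSimplex ℝ X) {Q : X × Y → ℝ}
    (hQ : ∀ z, 0 ≤ Q z) (hm : margX Q = P) : Q ∈ jointDists Y P := by
  refine ⟨⟨hQ, ?_⟩, hm⟩
  rw [Fintype.sum_prod_type, ← hP.2, ← hm]
  rfl

/-- A `ℚ`-linear map with `φ 1 = 1` fixes rationals, hence the marginal `P`; zeros go to zeros,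
hence the support condition survives. -/
theorem rat_mem_supportedDists {W : X → Y → ℝ} {P : X → ℝ} (hP : P ∈ stdSimplex ℝ X)
    (hPrat : ∀ x, ∃ r : ℚ, P x = r) {φ : ℝ →ₗ[ℚ] ℚ} (hφ : φ 1 = 1) {Q : X × Y → ℝ}
    (hQ : Q ∈ supportedDists W P) (h0 : ∀ z, 0 ≤ φ (Q z)) :
    (fun z => (φ (Q z) : ℝ)) ∈ supportedDists W P := by
  refine ⟨mem_jointDists_of_nonneg hP (fun z => by exact_mod_cast h0 z) (funext fun x => ?_),
    fun x y h => ?_⟩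
  · have h1 : margX (fun z => (φ (Q z) : ℝ)) x = ((φ (margX Q x) : ℚ) : ℝ) := by
      simp [margX]
    obtain ⟨r, hr⟩ := hPrat x
    have h2 : (r : ℝ) = r • (1 : ℝ) := by simp [Rat.smul_def]
    rw [h1, hQ.1.2, hr, h2, map_smul, hφ]
    simp [Rat.smul_def]
  · simp [hQ.2 x y h]

/-- Triples of rational joint distributions with a common `Y`-marginal are dense. -/
theorem exists_rational_triple {W : X → Y → ℝ} {P : X → ℝ} (hP : P ∈ stdSimplex ℝ X)
    (hPrat : ∀ x, ∃ r : ℚ, P x = r) {Q₁ Q₂ Q₃ : X × Y → ℝ} (h₁ : Q₁ ∈ supportedDists W P)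
    (h₂ : Q₂ ∈ supportedDists W P) (h₃ : Q₃ ∈ supportedDists W P) (h₂₁ : margY Q₂ = margY Q₁)
    (h₃₁ : margY Q₃ = margY Q₁) {p : (X × Y → ℝ) × (X × Y → ℝ) × (X × Y → ℝ) → Prop}
    (hp : ∀ᶠ T in nhds (Q₁, Q₂, Q₃), p T) :
    ∃ S₁ ∈ supportedDists W P, ∃ S₂ ∈ supportedDists W P, ∃ S₃ ∈ supportedDists W P,
      margY S₂ = margY S₁ ∧ margY S₃ = margY S₁ ∧ p (S₁, S₂, S₃) ∧
      (∀ z, ∃ r : ℚ, S₁ z = r) ∧ (∀ z, ∃ r : ℚ, S₂ z = r) ∧ ∀ z, ∃ r : ℚ, S₃ z = r := by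
  obtain ⟨ε, hε, hball⟩ := Metric.eventually_nhds_iff.1 hp
  -- One map serves all three distributions at once, so that their `Y`-marginals remain equal.
  obtain ⟨φ, hφ1, hφ, hφ0⟩ := exists_linearMap_rat_near_nonneg
    (Sum.elim Q₁ (Sum.elim Q₂ Q₃)) hε
  have hmarg : ∀ {Q Q' : X × Y → ℝ}, margY Q = margY Q' →
      margY (fun z => (φ (Q z) : ℝ)) = margY (fun z => (φ (Q' z) : ℝ)) := by
    intro Q Q' h
    have h1 : ∀ Q : X × Y → ℝ, ∀ y, margY (fun z => (φ (Q z) : ℝ)) y = ((φ (margY Q y) : ℚ) : ℝ) := by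
      intro Q y
      simp [margY]
    ext y
    rw [h1, h1, h]
  refine ⟨_, rat_mem_supportedDists hP hPrat hφ1 h₁ fun z => hφ0 (Sum.inl z) (h₁.1.1.1 z),
    _, rat_mem_supportedDists hP hPrat hφ1 h₂ fun z => hφ0 (Sum.inr (Sum.inl z)) (h₂.1.1.1 z),
    _, rat_mem_supportedDists hP hPrat hφ1 h₃ fun z => hφ0 (Sum.inr (Sum.inr z)) (h₃.1.1.1 z),
    hmarg h₂₁, hmarg h₃₁, hball ?_, fun z => ⟨_, rfl⟩, fun z => ⟨_, rfl⟩, fun z => ⟨_, rfl⟩⟩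
  rw [Prod.dist_eq, Prod.dist_eq]
  refine max_lt ?_ (max_lt ?_ ?_)
  · exact (dist_pi_lt_iff hε).2 fun z => hφ (Sum.inl z)
  · exact (dist_pi_lt_iff hε).2 fun z => hφ (Sum.inr (Sum.inl z))
  · exact (dist_pi_lt_iff hε).2 fun z => hφ (Sum.inr (Sum.inr z))

end Approximation

/-! ### Perturbation of joint distributions and the converse bound. -/

section Optimization

variable {X Y : Type*} [Fintype X] [Fintype Y]

/-- The mutual information of a joint distribution as a combination of entropies. -/
noncomputable def entropicInfo (Q : X × Y → ℝ) : ℝ :=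
  entropy (margX Q) + entropy (margY Q) - entropy Q

@[fun_prop]
theorem continuous_entropicInfo : Continuous (entropicInfo : (X × Y → ℝ) → ℝ) := by
  unfold entropicInfo
  fun_prop

theorem supportedDists_add_smul_mem {W : X → Y → ℝ} {P : X → ℝ} (hP : P ∈ stdSimplex ℝ X)
    {Q Q' : X × Y → ℝ} (hQ : Q ∈ supportedDists W P) (hQ' : Q' ∈ supportedDists W P) {a b : ℝ}
    (ha : 0 ≤ a) (hb : 0 ≤ b) (hab : a + b = 1) : a • Q + b • Q' ∈ supportedDists W P := by
  refine ⟨mem_jointDists_of_nonneg hP (fun z => ?_) ?_, hQ.2.add_smul hQ'.2 a b⟩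
  · exact add_nonneg (mul_nonneg ha (hQ.1.1.1 z)) (mul_nonneg hb (hQ'.1.1.1 z))
  · rw [margX_add_smul, hQ.1.2, hQ'.1.2, ← add_smul, hab, one_smul]

theorem margY_add_smul_sub (t : ℝ) (M Q Q' : X × Y → ℝ) :
    margY (M + t • (Q - Q')) = margY M + t • (margY Q - margY Q') := by
  ext y
  simp [margY, Finset.sum_add_distrib, Finset.mul_sum, mul_sub]

theorem margX_add_smul_sub (t : ℝ) (M Q Q' : X × Y → ℝ) :
    margX (M + t • (Q - Q')) = margX M + t • (margX Q - margX Q') := by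
  ext y
  simp [margX, Finset.sum_add_distrib, Finset.mul_sum, mul_sub]

theorem realLogLik_add_smul_sub (W : X → Y → ℝ) (t : ℝ) (M Q Q' : X × Y → ℝ) :
    realLogLik W (M + t • (Q - Q')) =
      realLogLik W M + t * (realLogLik W Q - realLogLik W Q') := by
  simp [realLogLik, Finset.sum_add_distrib, Finset.mul_sum, add_mul, mul_sub, sub_mul, mul_assoc]

/-- `Q - Q'` has zero `X`-marginal and vanishes where `W` does, so nonnegativity is the only
constraint that a move along it can break. -/
theorem supportedDists_add_smul_sub_mem {W : X → Y → ℝ} {P : X → ℝ} (hP : P ∈ stdSimplex ℝ X)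
    {M Q Q' : X × Y → ℝ} (hM : M ∈ supportedDists W P) (hQ : Q ∈ supportedDists W P)
    (hQ' : Q' ∈ supportedDists W P) {t : ℝ} (h0 : ∀ z, 0 ≤ (M + t • (Q - Q')) z) :
    M + t • (Q - Q') ∈ supportedDists W P := by
  refine ⟨mem_jointDists_of_nonneg hP h0 ?_, fun x y h => ?_⟩
  · rw [margX_add_smul_sub, hM.1.2, hQ.1.2, hQ'.1.2, sub_self, smul_zero, add_zero]
  · simp [hM.2 x y h, hQ.2 x y h, hQ'.2 x y h]

theorem isCompact_supportedDists (W : X → Y → ℝ) (P : X → ℝ) :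
    IsCompact (supportedDists W P) := by
  refine (isCompact_stdSimplex ℝ (X × Y)).of_isClosed_subset ?_ fun Q hQ => hQ.1.1
  have h : supportedDists W P = stdSimplex ℝ (X × Y) ∩ {Q | margX Q = P} ∩
      ⋂ x, ⋂ y, {Q | W x y = 0 → Q (x, y) = 0} := by
    ext Q
    simp [supportedDists, jointDists, SupportedOn]
  rw [h]
  refine ((isClosed_stdSimplex ℝ _).inter (isClosed_eq continuous_margX continuous_const)).inter ?_
  refine isClosed_iInter fun x => isClosed_iInter fun y => ?_
  by_cases hw : W x y = 0
  · simpa [hw] using isClosed_eq (continuous_apply (x, y)) continuous_const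
  · simp [hw]

/-- Gibbs' inequality, from `log u ≤ u - 1` at `u = P(x) W(y|x) / Q(x, y)`. -/
theorem realCondDiv_nonneg {W : X → Y → ℝ} (hW : ∀ x, W x ∈ stdSimplex ℝ Y) {P : X → ℝ}
    {Q : X × Y → ℝ} (hQ : Q ∈ supportedDists W P) : 0 ≤ realCondDiv W P Q := by
  obtain ⟨⟨⟨hQ0, hQ1⟩, rfl⟩, hS⟩ := hQ
  have hterm : ∀ x y, Q (x, y) * Real.log (margX Q x) + Q (x, y) * Real.log (W x y)
      - Q (x, y) * Real.log (Q (x, y)) ≤ margX Q x * W x y - Q (x, y) := by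
    intro x y
    rcases (hQ0 (x, y)).eq_or_lt with h0 | h0
    · rw [← h0]
      simpa using mul_nonneg (margX_nonneg hQ0 x) ((hW x).1 y)
    · have hx := h0.trans_le (le_margX hQ0 x y)
      have hw : 0 < W x y := lt_of_le_of_ne ((hW x).1 y) fun h => h0.ne' (hS x y h.symm)
      have h := Real.log_le_sub_one_of_pos (div_pos (mul_pos hx hw) h0)
      rw [Real.log_div (mul_pos hx hw).ne' h0.ne', Real.log_mul hx.ne' hw.ne'] at h
      have h2 := mul_le_mul_of_nonneg_left h h0.le
      have h3 : Q (x, y) * (margX Q x * W x y / Q (x, y) - 1) = margX Q x * W x y - Q (x, y) := by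
        field_simp
      linarith
  have h := Finset.sum_le_sum fun x (_ : x ∈ Finset.univ) =>
    Finset.sum_le_sum fun y (_ : y ∈ Finset.univ) => hterm x y
  have hQ1' : ∑ x, ∑ y, Q (x, y) = 1 := by rw [← Fintype.sum_prod_type]; exact hQ1
  have hPW : ∑ x, ∑ y, margX Q x * W x y = 1 := by
    simp only [← Finset.mul_sum, (hW _).2, mul_one]
    exact hQ1'
  simp only [Finset.sum_sub_distrib, Finset.sum_add_distrib, sum_mul_log_margX, hQ1', hPW] at h
  rw [realCondDiv, entropy_eq_sum_sum, realLogLik]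
  linarith

/-- The joint distribution of input `P` and channel `W`. -/
def channelJoint (W : X → Y → ℝ) (P : X → ℝ) : X × Y → ℝ := fun z => P z.1 * W z.1 z.2

theorem channelJoint_mem {W : X → Y → ℝ} (hW : ∀ x, W x ∈ stdSimplex ℝ Y) {P : X → ℝ}
    (hP : P ∈ stdSimplex ℝ X) : channelJoint W P ∈ supportedDists W P := by
  refine ⟨mem_jointDists_of_nonneg hP (fun z => mul_nonneg (hP.1 _) ((hW _).1 _)) ?_,
    fun x y h => by simp [channelJoint, h]⟩
  ext x
  simp [margX, channelJoint, ← Finset.mul_sum, (hW x).2]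

theorem realCondDiv_channelJoint {W : X → Y → ℝ} (hW : ∀ x, W x ∈ stdSimplex ℝ Y) (P : X → ℝ) :
    realCondDiv W P (channelJoint W P) = 0 := by
  have h : ∀ x, ∑ y, W x y * Real.negMulLog (P x) = Real.negMulLog (P x) := fun x => by
    rw [← Finset.sum_mul, (hW x).2, one_mul]
  have h2 : entropy (channelJoint W P) = entropy P - realLogLik W (channelJoint W P) := by
    simp only [entropy, Fintype.sum_prod_type, channelJoint, Real.negMulLog_mul,
      Finset.sum_add_distrib, h, realLogLik]
    rw [sub_eq_add_neg, ← Finset.sum_neg_distrib]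
    simp only [← Finset.sum_neg_distrib]
    congr 1
    refine Finset.sum_congr rfl fun x _ => Finset.sum_congr rfl fun y _ => ?_
    rw [Real.negMulLog]
    ring
  rw [realCondDiv, h2]
  ring

/-- Either some distribution close to the channel law has the same output and a smaller
log-likelihood, or the log-likelihood is a function of the output distribution. -/
theorem exists_smaller_or_logLik_determined {W : X → Y → ℝ} (hW : ∀ x, W x ∈ stdSimplex ℝ Y)
    {P : X → ℝ} (hP : P ∈ stdSimplex ℝ X) {E : ℝ} (hE : 0 < E) :
    ∃ Q₀ ∈ supportedDists W P, margY Q₀ = margY (channelJoint W P) ∧ realCondDiv W P Q₀ < E ∧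
      (realLogLik W Q₀ < realLogLik W (channelJoint W P) ∨
        ∀ Q ∈ supportedDists W P, ∀ Q' ∈ supportedDists W P, margY Q = margY Q' →
          realLogLik W Q = realLogLik W Q') := by
  have hJ := channelJoint_mem hW hP
  by_cases hdet : ∀ Q ∈ supportedDists W P, ∀ Q' ∈ supportedDists W P, margY Q = margY Q' →
      realLogLik W Q = realLogLik W Q'
  · exact ⟨_, hJ, rfl, by rwa [realCondDiv_channelJoint hW], Or.inr hdet⟩
  obtain ⟨Q, hQ, Q', hQ', hY, hlt⟩ : ∃ Q ∈ supportedDists W P, ∃ Q' ∈ supportedDists W P,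
      margY Q = margY Q' ∧ realLogLik W Q < realLogLik W Q' := by
    push Not at hdet
    obtain ⟨Q, hQ, Q', hQ', hY, hne⟩ := hdet
    rcases lt_or_gt_of_ne hne with h | h
    exacts [⟨Q, hQ, Q', hQ', hY, h⟩, ⟨Q', hQ', Q, hQ, hY.symm, h⟩]
  have hcont : Continuous fun t : ℝ => channelJoint W P + t • (Q - Q') := by fun_prop
  have hdiv : ∀ᶠ t : ℝ in nhds 0, realCondDiv W P (channelJoint W P + t • (Q - Q')) < E := by
    refine ((continuous_realCondDiv W P).comp hcont).continuousAt.eventually_lt_const ?_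
    simpa [realCondDiv_channelJoint hW] using hE
  -- The channel law vanishes only where `P` or `W` does, and there every supported distribution
  -- vanishes too; its other entries are positive and tolerate a small move.
  have hnn : ∀ᶠ t : ℝ in nhds 0, ∀ z, 0 ≤ (channelJoint W P + t • (Q - Q')) z := by
    refine eventually_all.2 fun z => ?_
    rcases (hJ.1.1.1 z).eq_or_lt with h0 | h0
    · have hz : ∀ {Q : X × Y → ℝ}, Q ∈ supportedDists W P → Q z = 0 := by
        intro Q hQ
        rcases mul_eq_zero.1 h0.symm with h | h
        · refine le_antisymm ((le_margX hQ.1.1.1 z.1 z.2).trans_eq ?_) (hQ.1.1.1 z)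
          rw [hQ.1.2, h]
        · exact hQ.2 z.1 z.2 h
      refine Eventually.of_forall fun t => ?_
      simp [hz hQ, hz hQ', ← h0]
    · have : ContinuousAt (fun t : ℝ => (channelJoint W P + t • (Q - Q')) z) 0 :=
        ((continuous_apply z).comp hcont).continuousAt
      filter_upwards [this.eventually_const_lt (u := 0) (by simpa using h0)] with t ht using ht.le
  obtain ⟨t, ⟨h1, h2⟩, ht⟩ := (((hdiv.and hnn).filter_mono nhdsWithin_le_nhds).and
    (self_mem_nhdsWithin (s := Set.Ioi (0 : ℝ)))).exists
  refine ⟨_, supportedDists_add_smul_sub_mem hP hJ hQ hQ' h2, ?_, h1, Or.inl ?_⟩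
  · rw [margY_add_smul_sub, hY, sub_self, smul_zero, add_zero]
  · rw [realLogLik_add_smul_sub]
    have := mul_neg_of_pos_of_neg (Set.mem_Ioi.1 ht) (sub_neg.2 hlt)
    linarith

/-- The converse bound for a pair of joint types that is admitted with some slack. -/
theorem listExponent_le_of_lt {W : X → Y → ℝ} (hW : ∀ x y, 0 ≤ W x y)
    {P : X → ℝ} (hP : P ∈ stdSimplex ℝ X) (hPrat : ∀ x, ∃ r : ℚ, P x = r) {R E : ℝ} (hR : 0 < R)
    {g : (Y → ℝ) → EReal} (hg : (E : EReal) ≤ errorExponent W P R (outputDecoder W g))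
    {Qt Q Q' : X × Y → ℝ} (hQt : Qt ∈ supportedDists W P) (hQ : Q ∈ supportedDists W P)
    (hQ' : Q' ∈ supportedDists W P) (hY : margY Q = margY Qt) (hY' : margY Q' = margY Qt)
    (hD : realCondDiv W P Q' < E)
    (hf : realLogLik W Q' < realLogLik W Q ∨
      ∀ Q ∈ supportedDists W P, ∀ Q' ∈ supportedDists W P, margY Q = margY Q' →
        realLogLik W Q = realLogLik W Q') :
    listExponent W P R (outputDecoder W g) ≤
      ((realCondDiv W P Qt + entropicInfo Q - R : ℝ) : EReal) := by
  refine le_of_forall_gt_imp_ge_of_dense fun c hc => ?_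
  have hcoe : Continuous fun T : (X × Y → ℝ) × (X × Y → ℝ) × (X × Y → ℝ) =>
      ((realCondDiv W P T.1 + entropicInfo T.2.1 - R : ℝ) : EReal) :=
    continuous_coe_real_ereal.comp (by fun_prop)
  have hdiv : Continuous fun T : (X × Y → ℝ) × (X × Y → ℝ) × (X × Y → ℝ) =>
      realCondDiv W P T.2.2 := by fun_prop
  have hlik : Continuous fun T : (X × Y → ℝ) × (X × Y → ℝ) × (X × Y → ℝ) =>
      realLogLik W T.2.1 - realLogLik W T.2.2 := by fun_prop
  have hp₁ := (hcoe.tendsto (Qt, Q, Q')).eventually_lt_const hc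
  have hp₂ := (hdiv.tendsto (Qt, Q, Q')).eventually_lt_const hD
  -- The strict inequality is an open condition, and the alternative does not depend on the triple.
  have hp₃ : ∀ᶠ T in nhds (Qt, Q, Q'), realLogLik W T.2.2 < realLogLik W T.2.1 ∨
      ∀ Q ∈ supportedDists W P, ∀ Q' ∈ supportedDists W P, margY Q = margY Q' →
        realLogLik W Q = realLogLik W Q' := by
    rcases hf with hf | hf
    · filter_upwards [(hlik.tendsto (Qt, Q, Q')).eventually_const_lt (sub_pos.2 hf)]
        with T hT using Or.inl (sub_pos.1 hT)
    · exact Eventually.of_forall fun _ => Or.inr hf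
  obtain ⟨S₁, hS₁, S₂, hS₂, S₃, hS₃, hY₂, hY₃, ⟨hc', hDS, hfS⟩, hr₁, hr₂, hr₃⟩ :=
    exists_rational_triple hP hPrat hQt hQ hQ' hY hY' (hp₁.and (hp₂.and hp₃))
  have hthr := threshold_le_of_le_errorExponent hW hg hS₃.1 hS₃.2 hr₃ hDS
  have hle : realLogLik W S₃ ≤ realLogLik W S₂ := by
    rcases hfS with h | h
    exacts [h.le, (h _ hS₃ _ hS₂ (hY₃.trans hY₂.symm)).le]
  have hthr₂ : g (margY S₂) ≤ logLik W S₂ := by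
    rw [hY₂, ← hY₃, logLik_eq_realLogLik hW hS₂.2]
    rw [logLik_eq_realLogLik hW hS₃.2] at hthr
    exact hthr.trans (EReal.coe_le_coe_iff.2 hle)
  refine (listExponent_le hW hR hS₁.1 hS₂.1 hY₂ hS₁.2 hr₁ hr₂ hthr₂).trans ?_
  rw [mutualInfo_eq hS₂.1.1.1]
  exact hc'.le

/-- The converse bound: a decoder with error exponent at least `E` cannot beat the exponent of a
pair of joint types admitted by a distribution `Q'` of divergence at most `E`. -/
theorem listExponent_le_of_le_errorExponent {W : X → Y → ℝ} (hW : ∀ x, W x ∈ stdSimplex ℝ Y)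
    {P : X → ℝ} (hP : P ∈ stdSimplex ℝ X) (hPrat : ∀ x, ∃ r : ℚ, P x = r) {R E : ℝ} (hR : 0 < R)
    (hE : 0 < E) {g : (Y → ℝ) → EReal} (hg : (E : EReal) ≤ errorExponent W P R (outputDecoder W g))
    {Qt Q Q' : X × Y → ℝ} (hQt : Qt ∈ supportedDists W P) (hQ : Q ∈ supportedDists W P)
    (hQ' : Q' ∈ supportedDists W P) (hY : margY Q = margY Qt) (hY' : margY Q' = margY Qt)
    (hD : realCondDiv W P Q' ≤ E) (hf : realLogLik W Q' ≤ realLogLik W Q) :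
    listExponent W P R (outputDecoder W g) ≤
      ((realCondDiv W P Qt + entropicInfo Q - R : ℝ) : EReal) := by
  obtain ⟨Q₀, hQ₀, hY₀, hD₀, hf₀⟩ := exists_smaller_or_logLik_determined hW hP hE
  have hJ := channelJoint_mem hW hP
  set J := channelJoint W P
  -- `Qt` and `Q` are mixed with `J`, and `Q'` with `Q₀`, all with weight `ε`. As `Q₀` and `J` share
  -- their output, the three marginals stay equal, while `Q₀` supplies the slack in divergence and
  -- likelihood. Then `ε` tends to zero.
  have hcont : Continuous fun ε : ℝ => ((realCondDiv W P ((1 - ε) • Qt + ε • J) +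
      entropicInfo ((1 - ε) • Q + ε • J) - R : ℝ) : EReal) :=
    continuous_coe_real_ereal.comp (by fun_prop)
  have hlim := (hcont.tendsto 0).mono_left (nhdsWithin_le_nhds (s := Set.Ioi (0 : ℝ)))
  simp only [sub_zero, one_smul, zero_smul, add_zero] at hlim
  refine ge_of_tendsto hlim ?_
  filter_upwards [self_mem_nhdsWithin, nhdsWithin_le_nhds (Iio_mem_nhds one_pos)] with ε hε0 hε1
  replace hε1 : 0 < 1 - ε := sub_pos.2 hε1
  replace hε0 : 0 < ε := hε0
  have hadd : 1 - ε + ε = 1 := by ring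
  refine listExponent_le_of_lt (fun x => (hW x).1) hP hPrat hR hg
    (Q' := (1 - ε) • Q' + ε • Q₀)
    (supportedDists_add_smul_mem hP hQt hJ hε1.le hε0.le hadd)
    (supportedDists_add_smul_mem hP hQ hJ hε1.le hε0.le hadd)
    (supportedDists_add_smul_mem hP hQ' hQ₀ hε1.le hε0.le hadd)
    (by rw [margY_add_smul, margY_add_smul, hY])
    (by rw [margY_add_smul, margY_add_smul, hY', hY₀]) ?_ ?_
  · have h := realCondDiv_convex W P hQ'.1.1.1 hQ₀.1.1.1 hε1.le hε0.le hadd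
    have h1 := mul_le_mul_of_nonneg_left hD hε1.le
    have h2 := mul_lt_mul_of_pos_left hD₀ hε0
    linarith
  · refine hf₀.imp (fun hf₀ => ?_) fun h => h
    rw [realLogLik_add_smul, realLogLik_add_smul]
    exact add_lt_add_of_le_of_lt (mul_le_mul_of_nonneg_left hf hε1.le)
      (mul_lt_mul_of_pos_left hf₀ hε0)

/-! ### The threshold `g*` -/

theorem mem_gStarFeasible_iff {W : X → Y → ℝ} {P : X → ℝ} {E : ℝ} {q : Y → ℝ} {Q : X × Y → ℝ} :
    Q ∈ gStarFeasible W P E q ↔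
      Q ∈ supportedDists W P ∧ margY Q = q ∧ realCondDiv W P Q ≤ E := by
  constructor
  · rintro ⟨h1, h2, h3⟩
    obtain ⟨h4, h5⟩ := (condDivergence_le_coe_iff h1 E).1 h3
    exact ⟨⟨h1, h4⟩, h2, h5⟩
  · rintro ⟨h1, h2, h3⟩
    exact ⟨h1.1, h2, (condDivergence_le_coe_iff h1.1 E).2 ⟨h1.2, h3⟩⟩

theorem gStar_le {W : X → Y → ℝ} (hW : ∀ x y, 0 ≤ W x y) {P : X → ℝ} {E : ℝ}
    {Q : X × Y → ℝ} (hQ : Q ∈ supportedDists W P) (hD : realCondDiv W P Q ≤ E) :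
    gStar W P E (margY Q) ≤ (realLogLik W Q : EReal) := by
  rw [← logLik_eq_realLogLik hW hQ.2]
  exact iInf₂_le Q (mem_gStarFeasible_iff.2 ⟨hQ, rfl, hD⟩)

/-- Finite divergence forces the support condition, so the feasible set is compact and `f` is
continuous on it. -/
theorem exists_gStar_eq {W : X → Y → ℝ} (hW : ∀ x y, 0 ≤ W x y) {P : X → ℝ} {E : ℝ}
    {q : Y → ℝ} (h : (gStarFeasible W P E q).Nonempty) :
    ∃ Q ∈ gStarFeasible W P E q, gStar W P E q = (realLogLik W Q : EReal) := by
  have hcomp : IsCompact (gStarFeasible W P E q) := by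
    have : gStarFeasible W P E q =
        supportedDists W P ∩ ({Q | margY Q = q} ∩ {Q | realCondDiv W P Q ≤ E}) := by
      ext Q
      exact mem_gStarFeasible_iff
    rw [this]
    exact (isCompact_supportedDists W P).inter_right
      ((isClosed_eq continuous_margY continuous_const).inter
        (isClosed_le (continuous_realCondDiv W P) continuous_const))
  obtain ⟨Q, hQ, hmin⟩ := hcomp.exists_isMinOn h (continuous_realLogLik W).continuousOn
  refine ⟨Q, hQ, le_antisymm ?_ (le_iInf₂ fun Q' hQ' => ?_)⟩
  · obtain ⟨h1, h2, h3⟩ := mem_gStarFeasible_iff.1 hQ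
    exact h2 ▸ gStar_le hW h1 h3
  · rw [logLik_eq_realLogLik hW (mem_gStarFeasible_iff.1 hQ').1.2]
    exact EReal.coe_le_coe_iff.2 (hmin hQ')

theorem gStar_eq_top {W : X → Y → ℝ} {P : X → ℝ} {E : ℝ} {q : Y → ℝ}
    (h : ¬ (gStarFeasible W P E q).Nonempty) : gStar W P E q = ⊤ := by
  rw [Set.not_nonempty_iff_eq_empty] at h
  simp [gStar, h]

/-- The joint distributions with `X`-marginal `P` and conditional divergence at most `E`. -/
def divergenceBall (W : X → Y → ℝ) (P : X → ℝ) (E : ℝ) : Set (X × Y → ℝ) :=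
  supportedDists W P ∩ {Q | realCondDiv W P Q ≤ E}

theorem isCompact_divergenceBall (W : X → Y → ℝ) (P : X → ℝ) (E : ℝ) :
    IsCompact (divergenceBall W P E) :=
  (isCompact_supportedDists W P).inter_right
    (isClosed_le (continuous_realCondDiv W P) continuous_const)

theorem mem_image_margY_divergenceBall_iff {W : X → Y → ℝ} {P : X → ℝ} {E : ℝ} {q : Y → ℝ} :
    q ∈ margY '' divergenceBall W P E ↔ (gStarFeasible W P E q).Nonempty := by
  constructor
  · rintro ⟨Q, hQ, rfl⟩
    exact ⟨Q, mem_gStarFeasible_iff.2 ⟨hQ.1, rfl, hQ.2⟩⟩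
  · rintro ⟨Q, hQ⟩
    obtain ⟨h1, h2, h3⟩ := mem_gStarFeasible_iff.1 hQ
    exact ⟨Q, ⟨h1, h3⟩, h2⟩

/-- Lower semicontinuity is compactness of the optimizers. For upper semicontinuity, a near-optimal
point strictly inside the divergence ball can be moved to any nearby feasible output without leaving
the ball; strict convexity supplies such a point. -/
theorem gStar_continuousOn {W : X → Y → ℝ} (hW : ∀ x y, 0 ≤ W x y) {P : X → ℝ}
    (hP : P ∈ stdSimplex ℝ X) (E : ℝ) :
    ContinuousOn (gStar W P E) (margY '' divergenceBall W P E) := by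
  intro q hq
  obtain ⟨Q, hQF, hQ⟩ := exists_gStar_eq hW (mem_image_margY_divergenceBall_iff.1 hq)
  obtain ⟨hQA, hQY, hQD⟩ := mem_gStarFeasible_iff.1 hQF
  -- limits of optimal points along a sequence of outputs
  have hseq : ∀ p : (Y → ℝ) → Prop,
      (∃ᶠ r in nhdsWithin q (margY '' divergenceBall W P E), p r) →
      ∃ S : ℕ → X × Y → ℝ, ∃ Q' ∈ divergenceBall W P E, (∀ k, S k ∈ divergenceBall W P E) ∧
        (∀ k, p (margY (S k))) ∧ Tendsto S atTop (nhds Q') ∧ margY Q' = q ∧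
        ∀ k, gStar W P E (margY (S k)) = (realLogLik W (S k) : EReal) := by
    intro p hp
    obtain ⟨u, hu, hup⟩ := exists_seq_forall_of_frequently
      (hp.and_eventually self_mem_nhdsWithin)
    have hopt : ∀ k, ∃ S ∈ divergenceBall W P E, margY S = u k ∧
        gStar W P E (u k) = (realLogLik W S : EReal) := by
      intro k
      obtain ⟨S, hS, hSe⟩ := exists_gStar_eq hW (mem_image_margY_divergenceBall_iff.1 (hup k).2)
      obtain ⟨h1, h2, h3⟩ := mem_gStarFeasible_iff.1 hS
      exact ⟨S, ⟨h1, h3⟩, h2, hSe⟩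
    choose S hSB hSY hSe using hopt
    obtain ⟨Q', hQ', ψ, hψ, hlim⟩ := (isCompact_divergenceBall W P E).tendsto_subseq hSB
    refine ⟨S ∘ ψ, Q', hQ', fun k => hSB _, fun k => ?_, hlim, ?_, fun k => ?_⟩
    · rw [Function.comp_apply, hSY]
      exact (hup _).1
    · refine tendsto_nhds_unique ((continuous_margY.tendsto Q').comp hlim) ?_
      refine ((hu.mono_right nhdsWithin_le_nhds).comp hψ.tendsto_atTop).congr fun k => ?_
      simp [hSY]
    · rw [Function.comp_apply, hSY, hSe]
  refine tendsto_order.2 ⟨fun c hc => ?_, fun c hc => ?_⟩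
  · by_contra hcon
    obtain ⟨S, Q', hQ', hSB, hSp, hlim, hY', hSe⟩ := hseq (fun r => ¬ c < gStar W P E r) (not_eventually.1 hcon)
    have h1 : Tendsto (fun k => (realLogLik W (S k) : EReal)) atTop
        (nhds (realLogLik W Q' : EReal)) :=
      ((continuous_coe_real_ereal.comp (continuous_realLogLik W)).tendsto Q').comp hlim
    have h2 : (realLogLik W Q' : EReal) ≤ c :=
      le_of_tendsto' h1 fun k => by rw [← hSe]; exact not_lt.1 (hSp k)
    have h3 := gStar_le hW hQ'.1 hQ'.2
    rw [hY'] at h3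
    exact absurd hc (not_lt.2 (h3.trans h2))
  · by_contra hcon
    obtain ⟨S, Q', hQ', hSB, hSp, hlim, hY', hSe⟩ := hseq (fun r => ¬ gStar W P E r < c) (not_eventually.1 hcon)
    by_cases hne : Q = Q'
    · have h1 : Tendsto (fun k => (realLogLik W (S k) : EReal)) atTop
          (nhds (realLogLik W Q' : EReal)) :=
        ((continuous_coe_real_ereal.comp (continuous_realLogLik W)).tendsto Q').comp hlim
      have h2 : c ≤ (realLogLik W Q' : EReal) :=
        ge_of_tendsto' h1 fun k => by rw [← hSe]; exact not_lt.1 (hSp k)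
      rw [hQ, hne] at hc
      exact absurd hc (not_lt.2 h2)
    -- move from `Q` towards `Q'`, into the interior of the divergence ball
    have hmix : Continuous fun ε : ℝ => (realLogLik W ((1 - ε) • Q + ε • Q') : EReal) :=
      continuous_coe_real_ereal.comp (by fun_prop)
    have hev : ∀ᶠ ε : ℝ in nhds 0, (realLogLik W ((1 - ε) • Q + ε • Q') : EReal) < c := by
      refine hmix.continuousAt.eventually_lt_const ?_
      simpa [← hQ] using hc
    obtain ⟨ε, ⟨hfε, hε1⟩, hε0⟩ := (((hev.and (Iio_mem_nhds one_pos)).filter_mono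
      nhdsWithin_le_nhds).and (self_mem_nhdsWithin (s := Set.Ioi (0 : ℝ)))).exists
    replace hε1 : 0 < 1 - ε := sub_pos.2 hε1
    replace hε0 : 0 < ε := hε0
    have hadd : 1 - ε + ε = 1 := by ring
    have hDε : realCondDiv W P ((1 - ε) • Q + ε • Q') < E := by
      have h := realCondDiv_strictConvex W P hQA.1.1.1 hQ'.1.1.1.1 hne hε1 hε0 hadd
      have h1 := mul_le_mul_of_nonneg_left hQD hε1.le
      have h2 : ε * realCondDiv W P Q' ≤ ε * E := mul_le_mul_of_nonneg_left hQ'.2 hε0.le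
      linarith
    have hMA := supportedDists_add_smul_mem hP hQA hQ'.1 hε1.le hε0.le hadd
    have hMY : margY ((1 - ε) • Q + ε • Q') = q := by
      rw [margY_add_smul, hQY, hY', ← add_smul, hadd, one_smul]
    set M := (1 - ε) • Q + ε • Q' with hM_def
    -- Since `M` and `Q'` have the same output `q`, adding `S k - Q'` gives `M` exactly the output
    -- of `S k`.
    have hTlim : Tendsto (fun k => M + (1 : ℝ) • (S k - Q')) atTop (nhds M) := by
      have : Tendsto (fun k => M + (1 : ℝ) • (S k - Q')) atTop
          (nhds (M + (1 : ℝ) • (Q' - Q'))) :=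
        ((hlim.sub_const Q').const_smul (1 : ℝ)).const_add M
      simpa using this
    have hnn : ∀ᶠ k in atTop, ∀ z, 0 ≤ (M + (1 : ℝ) • (S k - Q')) z := by
      refine eventually_all.2 fun z => ?_
      rcases (hMA.1.1.1 z).eq_or_lt with h0 | h0
      -- Where the mixture `M` vanishes so does `Q'`, which has positive weight in it; the shifted
      -- entry is then `S k z`.
      · have hQ'z : Q' z = 0 := by
          have e : M z = (1 - ε) * Q z + ε * Q' z := rfl
          have e1 := mul_nonneg hε1.le (hQA.1.1.1 z)
          have e2 := hQ'.1.1.1.1 z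
          have e3 : ε * Q' z = 0 := by
            have := mul_nonneg hε0.le e2
            linarith
          exact (mul_eq_zero.1 e3).resolve_left hε0.ne'
        refine Eventually.of_forall fun k => ?_
        have := (hSB k).1.1.1.1 z
        simpa [← h0, hQ'z] using this
      · filter_upwards [((continuous_apply z).tendsto M).comp hTlim |>.eventually_const_lt h0]
          with k hk using hk.le
    have hD : ∀ᶠ k in atTop, realCondDiv W P (M + (1 : ℝ) • (S k - Q')) < E :=
      (((continuous_realCondDiv W P).tendsto M).comp hTlim).eventually_lt_const hDε
    have hf : ∀ᶠ k in atTop, (realLogLik W (M + (1 : ℝ) • (S k - Q')) : EReal) < c :=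
      (((continuous_coe_real_ereal.comp (continuous_realLogLik W)).tendsto M).comp
        hTlim).eventually_lt_const hfε
    obtain ⟨k, h1, h2, h3⟩ := (hnn.and (hD.and hf)).exists
    have h4 := gStar_le hW (supportedDists_add_smul_sub_mem hP hMA (hSB k).1 hQ'.1 h1) h2.le
    rw [margY_add_smul_sub, hMY, hY', one_smul, add_sub_cancel] at h4
    exact hSp k (h4.trans_lt h3)

theorem isOutputThreshold_gStar {W : X → Y → ℝ} (hW : ∀ x y, 0 ≤ W x y) {P : X → ℝ}
    (hP : P ∈ stdSimplex ℝ X) (E : ℝ) : IsOutputThreshold (gStar W P E) := by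
  refine ⟨margY '' divergenceBall W P E, ?_, (isCompact_divergenceBall W P E).image continuous_margY,
    gStar_continuousOn hW hP E, fun q hq => ?_, fun q _ hq => ?_⟩
  · rintro _ ⟨Q, hQ, rfl⟩
    exact margY_mem_stdSimplex hQ.1.1.1
  · obtain ⟨Q, -, h⟩ := exists_gStar_eq hW (mem_image_margY_divergenceBall_iff.1 hq)
    rw [h]
    exact ⟨EReal.coe_ne_top _, EReal.coe_ne_bot _⟩
  · exact gStar_eq_top fun h => hq (mem_image_margY_divergenceBall_iff.2 h)

/-- Every supported `Q` of divergence at most `E` competes in the minimum that defines `gStar`, so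
it passes. -/
theorem le_errorExponent_gStar {W : X → Y → ℝ} (hW : ∀ x y, 0 ≤ W x y) (P : X → ℝ) (R E : ℝ) :
    (E : EReal) ≤ errorExponent W P R (outputDecoder W (gStar W P E)) := by
  refine le_errorExponent hW R fun Q hQ hS hbad => ?_
  by_contra hlt
  refine hbad ?_
  rw [logLik_eq_realLogLik hW hS]
  exact gStar_le hW ⟨hQ, hS⟩ (not_le.1 hlt).le

/-- A distribution that meets the threshold `g*` does so thanks to one of divergence at most `E`. -/
theorem exists_witness_of_gStar_le {W : X → Y → ℝ} (hW : ∀ x y, 0 ≤ W x y) {P : X → ℝ} {E : ℝ}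
    {Q : X × Y → ℝ} (hQ : Q ∈ jointDists Y P) (h : gStar W P E (margY Q) ≤ logLik W Q) :
    Q ∈ supportedDists W P ∧ ∃ Q' ∈ supportedDists W P, margY Q' = margY Q ∧
      realCondDiv W P Q' ≤ E ∧ realLogLik W Q' ≤ realLogLik W Q := by
  by_cases hne : (gStarFeasible W P E (margY Q)).Nonempty
  · obtain ⟨Q', hQ', he⟩ := exists_gStar_eq hW hne
    obtain ⟨h1, h2, h3⟩ := mem_gStarFeasible_iff.1 hQ'
    have hS : SupportedOn W Q := by
      by_contra hS
      rw [logLik_eq_bot hQ.1.1 hS, he, le_bot_iff] at h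
      exact EReal.coe_ne_bot _ h
    rw [he, logLik_eq_realLogLik hW hS] at h
    exact ⟨⟨hQ, hS⟩, Q', h1, h2, h3, EReal.coe_le_coe_iff.1 h⟩
  · exfalso
    rw [gStar_eq_top hne, top_le_iff] at h
    by_cases hS : SupportedOn W Q
    · rw [logLik_eq_realLogLik hW hS] at h
      exact EReal.coe_ne_top _ h
    · rw [logLik_eq_bot hQ.1.1 hS] at h
      exact bot_ne_top h

theorem listObjective_eq_coe {W : X → Y → ℝ} {P : X → ℝ} (R : ℝ) {Qt Q : X × Y → ℝ}
    (hQt : Qt ∈ supportedDists W P) (hQ : ∀ z, 0 ≤ Q z) :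
    listObjective W P R Qt Q = ((realCondDiv W P Qt + entropicInfo Q - R : ℝ) : EReal) := by
  rw [listObjective, condDivergence_eq_coe hQt.1 hQt.2, mutualInfo_eq hQ, ← EReal.coe_add,
    ← add_sub_assoc]
  rfl

theorem listObjective_eq_top {W : X → Y → ℝ} {P : X → ℝ} (R : ℝ) {Qt : X × Y → ℝ} (Q : X × Y → ℝ)
    (hQt : Qt ∈ jointDists Y P) (hS : ¬ SupportedOn W Qt) : listObjective W P R Qt Q = ⊤ := by
  rw [listObjective, condDivergence_eq_top hQt hS, EReal.top_add_coe]

/-- The list size exponent of the threshold `g*`. -/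
noncomputable def optimalListExponent (W : X → Y → ℝ) (P : X → ℝ) (R E : ℝ) : EReal :=
  ⨅ Qt ∈ jointDists Y P, ⨅ Q ∈ listFeasible W P (gStar W P E) Qt, listObjective W P R Qt Q

theorem listExponent_le_optimalListExponent {W : X → Y → ℝ} (hW : ∀ x, W x ∈ stdSimplex ℝ Y)
    {P : X → ℝ} (hP : P ∈ stdSimplex ℝ X) (hPrat : ∀ x, ∃ r : ℚ, P x = r) {R E : ℝ} (hR : 0 < R)
    (hE : E ≠ 0) {g : (Y → ℝ) → EReal}
    (hg : (E : EReal) ≤ errorExponent W P R (outputDecoder W g)) :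
    listExponent W P R (outputDecoder W g) ≤ optimalListExponent W P R E := by
  refine le_iInf₂ fun Qt hQt => le_iInf₂ fun Q hQ => ?_
  by_cases hS : SupportedOn W Qt
  · obtain ⟨hQA, Q', hQ', hY', hD, hf⟩ :=
      exists_witness_of_gStar_le (fun x => (hW x).1) hQ.1 hQ.2.2
    -- The witness has nonnegative divergence at most `E`, and `E = 0` is excluded.
    have hE' : 0 < E := lt_of_le_of_ne ((realCondDiv_nonneg hW hQ').trans hD) hE.symm
    rw [listObjective_eq_coe R ⟨hQt, hS⟩ hQA.1.1.1]
    exact listExponent_le_of_le_errorExponent hW hP hPrat hR hE' hg ⟨hQt, hS⟩ hQA hQ' hQ.2.1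
      (hY'.trans hQ.2.1) hD hf
  · rw [listObjective_eq_top R Q hQt hS]
    exact le_top

theorem optimalListExponent_le_listExponent {W : X → Y → ℝ} (hW : ∀ x y, 0 ≤ W x y) (P : X → ℝ)
    (R E : ℝ) :
    optimalListExponent W P R E ≤ listExponent W P R (outputDecoder W (gStar W P E)) := by
  refine EReal.ge_of_forall_gt_iff_ge.1 fun v hv => ?_
  refine le_listExponent hW R fun Qt hQt hS Q hQ => ?_
  have h := hv.trans_le ((iInf₂_le Qt hQt).trans (iInf₂_le Q hQ))
  rw [listObjective, condDivergence_eq_coe hQt hS, ← EReal.coe_add, EReal.coe_lt_coe_iff] at h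
  linarith

/-- Carrying the witness `Q'` as a third coordinate turns the threshold condition into closed
conditions, so a continuous function is minimized over a compact set of triples. -/
theorem exists_listObjective_eq {W : X → Y → ℝ} (hW : ∀ x y, 0 ≤ W x y) (P : X → ℝ)
    (R E : ℝ) (h : ∃ Qt ∈ jointDists Y P, (listFeasible W P (gStar W P E) Qt).Nonempty) :
    ∃ Qt ∈ jointDists Y P, ∃ Q ∈ listFeasible W P (gStar W P E) Qt,
      optimalListExponent W P R E = listObjective W P R Qt Q := by
  set K : Set ((X × Y → ℝ) × (X × Y → ℝ) × (X × Y → ℝ)) :=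
    (supportedDists W P ×ˢ supportedDists W P ×ˢ supportedDists W P) ∩
      ({T | margY T.2.1 = margY T.1} ∩ ({T | margY T.2.2 = margY T.2.1} ∩
        ({T | realCondDiv W P T.2.2 ≤ E} ∩ {T | realLogLik W T.2.2 ≤ realLogLik W T.2.1})))
    with hK_def
  have hA := isCompact_supportedDists W P
  have hK : IsCompact K := by
    refine (hA.prod (hA.prod hA)).inter_right (IsClosed.inter ?_ (IsClosed.inter ?_
      (IsClosed.inter ?_ ?_)))
    · exact isClosed_eq (by fun_prop) (by fun_prop)
    · exact isClosed_eq (by fun_prop) (by fun_prop)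
    · exact isClosed_le (by fun_prop) (by fun_prop)
    · exact isClosed_le (by fun_prop) (by fun_prop)
  have hne : K.Nonempty := by
    obtain ⟨Qt, hQt, Q, hQ⟩ := h
    obtain ⟨hQA, Q', hQ', hY', hD, hf⟩ := exists_witness_of_gStar_le hW hQ.1 hQ.2.2
    -- The given `Qt` may have infinite divergence; `Q'` has the same output and replaces it.
    exact ⟨(Q', Q, Q'), ⟨hQ', hQA, hQ'⟩, hY'.symm, hY', hD, hf⟩
  obtain ⟨T, ⟨⟨hT₁, hT₂, hT₃⟩, hY₁, hY₂, hD, hf⟩, hmin⟩ := hK.exists_isMinOn hne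
    (f := fun T => realCondDiv W P T.1 + entropicInfo T.2.1 - R)
    (Continuous.continuousOn (by fun_prop))
  have hfeas : T.2.1 ∈ listFeasible W P (gStar W P E) T.1 := by
    refine ⟨hT₂.1, hY₁, ?_⟩
    rw [logLik_eq_realLogLik hW hT₂.2]
    have h1 := gStar_le hW hT₃ hD
    rw [hY₂] at h1
    exact h1.trans (EReal.coe_le_coe_iff.2 hf)
  refine ⟨T.1, hT₁.1, T.2.1, hfeas, le_antisymm ((iInf₂_le T.1 hT₁.1).trans (iInf₂_le T.2.1 hfeas))
    (le_iInf₂ fun Qt hQt => le_iInf₂ fun Q hQ => ?_)⟩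
  by_cases hS : SupportedOn W Qt
  · obtain ⟨hQA, Q', hQ', hY', hD', hf'⟩ := exists_witness_of_gStar_le hW hQ.1 hQ.2.2
    rw [listObjective_eq_coe R hT₁ hT₂.1.1.1, listObjective_eq_coe R ⟨hQt, hS⟩ hQA.1.1.1]
    exact EReal.coe_le_coe_iff.2 (hmin (a := (Qt, Q, Q'))
      ⟨⟨⟨hQt, hS⟩, hQA, hQ'⟩, hQ.2.1, hY', hD', hf'⟩)
  · rw [listObjective_eq_top R Q hQt hS]
    exact le_top

end Optimization

end ThresholdDecoding

theorem theorem2 {X Y : Type*} [Fintype X] [Fintype Y]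
    (W : X → Y → ℝ) (hW : ∀ x, W x ∈ stdSimplex ℝ Y)
    (P : X → ℝ) (hP : P ∈ stdSimplex ℝ X) (hPrat : ∀ x, ∃ r : ℚ, P x = (r : ℝ))
    (R : ℝ) (hR : 0 < R) (E : ℝ) (hE : E ≠ 0) :
    -- the minimum that defines `g*` is attained whenever it is feasible
    (∀ q ∈ stdSimplex ℝ Y, (ThresholdDecoding.gStarFeasible W P E q).Nonempty →
      ∃ Q ∈ ThresholdDecoding.gStarFeasible W P E q,
        ThresholdDecoding.gStar W P E q = ThresholdDecoding.logLik W Q) ∧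
    -- `g*` is an optimal threshold function
    ThresholdDecoding.IsOptimalOutputThreshold W P R E (ThresholdDecoding.gStar W P E) ∧
    -- the resulting list size exponent
    ThresholdDecoding.listExponent W P R
        (ThresholdDecoding.outputDecoder W (ThresholdDecoding.gStar W P E)) =
      (⨅ Qt ∈ ThresholdDecoding.jointDists Y P,
        ⨅ Q ∈ ThresholdDecoding.listFeasible W P (ThresholdDecoding.gStar W P E) Qt,
          ThresholdDecoding.listObjective W P R Qt Q) ∧
    -- and its double minimum is attained whenever it is feasible
    ((∃ Qt ∈ ThresholdDecoding.jointDists Y P,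
        (ThresholdDecoding.listFeasible W P (ThresholdDecoding.gStar W P E) Qt).Nonempty) →
      ∃ Qt ∈ ThresholdDecoding.jointDists Y P,
        ∃ Q ∈ ThresholdDecoding.listFeasible W P (ThresholdDecoding.gStar W P E) Qt,
          ThresholdDecoding.listExponent W P R
              (ThresholdDecoding.outputDecoder W (ThresholdDecoding.gStar W P E)) =
            ThresholdDecoding.listObjective W P R Qt Q) := by
  have hW0 : ∀ x y, 0 ≤ W x y := fun x => (hW x).1
  have hle := ThresholdDecoding.le_errorExponent_gStar hW0 P R E
  -- The threshold `g*` itself meets the error constraint, so the converse applies to it and matches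
  -- the achievability bound.
  have hexp : ThresholdDecoding.listExponent W P R
      (ThresholdDecoding.outputDecoder W (ThresholdDecoding.gStar W P E)) =
        ThresholdDecoding.optimalListExponent W P R E :=
    le_antisymm (ThresholdDecoding.listExponent_le_optimalListExponent hW hP hPrat hR hE hle)
      (ThresholdDecoding.optimalListExponent_le_listExponent hW0 P R E)
  refine ⟨fun q _ hq => ?_, ⟨ThresholdDecoding.isOutputThreshold_gStar hW0 hP E, hle,
    fun g' _ hg' => ?_⟩, hexp, fun h => ?_⟩
  · obtain ⟨Q, hQ, hval⟩ := ThresholdDecoding.exists_gStar_eq hW0 hq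
    refine ⟨Q, hQ, hval.trans ?_⟩
    rw [ThresholdDecoding.logLik_eq_realLogLik hW0
      (ThresholdDecoding.mem_gStarFeasible_iff.1 hQ).1.2]
  · rw [hexp]
    exact ThresholdDecoding.listExponent_le_optimalListExponent hW hP hPrat hR hE hg'
  · rw [hexp]
    exact ThresholdDecoding.exists_listObjective_eq hW0 P R E h
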